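/- Let $t>0$ and $\rho>t+1$, and let $E$ be the bounded operator on $\ell^2(\mathbb N)$, $\mathbb N=\{1,2,3,\dots\}$, with matrix $$\left\{\frac{[n,m]^t}{(nm)^{(\rho+t)/2}}\right\}_{n,m=1}^\infty ,$$ where $[n,m]$ is the least common multiple of $n$ and $m$. Then $E$ has infinitely many positive and infinitely many negative eigenvalues. The positive eigenvalues of $E$ can be listed in non-increasing order with multiplicities as $\{\lambda_n^+(E)\}_{n=1}^\infty$, and likewise the positive eigenvalues of $-E$ as $\{\lambda_n^-(E)\}_{n=1}^\infty$. The counting functions $$\mu^\pm(x)=\#\{n\in\mathbb N:\lambda_n^\pm(E)>1/x\},\qquad x>0,$$ are finite and non-decreasing. Define $$f^\pm(s)=\int_0^\infty x^{-s}\,d\mu^\pm(x)=\sum_{n=1}^\infty \lambda_n^\pm(E)^s .$$ For each sign, the integral and the series converge absolutely, and they are equal, for $\operatorname{Re}s>\frac1{\rho-t}$. Furthermore, let $f=f^++f^-$ and $h=f^+-f^-$. There are a real number $s_1<\frac1{\rho-t}$ and functions $\widetilde f,\widetilde h$ analytic in the half-plane $\operatorname{Re}s>s_1$ such that for all $s$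 with $\operatorname{Re}s>\frac1{\rho-t}$ $$f(s)=\zeta((\rho-t)s)\,\widetilde f(s)\qquad\text{and}\qquad h(s)=\frac{\widetilde h(s)}{\zeta((\rho-t)s)},$$ where $\zeta$ is the Riemann zeta function. -/

import Mathlib

open MeasureTheory

noncomputable section

/-- The complex Hilbert space `ℓ²(ℕ)`, `ℕ = {1, 2, 3, …}`. -/
abbrev EllTwo : Type := lp (fun _ : ℕ+ => ℂ) 2

/-- The function `n ↦ conj (a n)` as an element of `ℓ²`. -/
def conjRow (r : ℕ+ → ℂ) (hr : Summable fun m => ‖r m‖ ^ 2) : EllTwo :=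
  ⟨fun m => (starRingEnd ℂ) (r m), memℓp_gen (by simpa using hr)⟩

theorem inner_conjRow (r : ℕ+ → ℂ) (hr : Summable fun m => ‖r m‖ ^ 2) (x : EllTwo) :
    HasSum (fun m => r m * x m) (inner ℂ (conjRow r hr) x) := by
  have h := lp.hasSum_inner (𝕜 := ℂ) (conjRow r hr) x
  simpa [conjRow, mul_comm] using h

theorem norm_conjRow_sq (r : ℕ+ → ℂ) (hr : Summable fun m => ‖r m‖ ^ 2) :
    ‖conjRow r hr‖ ^ 2 = ∑' m, ‖r m‖ ^ 2 := by
  have h := lp.norm_rpow_eq_tsum (p := 2) (by norm_num) (conjRow r hr)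
  simpa [conjRow] using h

theorem norm_tsum_row_sq_le (r : ℕ+ → ℂ) (hr : Summable fun m => ‖r m‖ ^ 2) (x : EllTwo) :
    ‖∑' m, r m * x m‖ ^ 2 ≤ (∑' m, ‖r m‖ ^ 2) * ‖x‖ ^ 2 := by
  rw [(inner_conjRow r hr x).tsum_eq, ← norm_conjRow_sq r hr, ← mul_pow]
  gcongr
  exact norm_inner_le_norm _ _

/-- The bounded operator on `ℓ²(ℕ)` given by a square-summable matrix `a`:
`(A x)_n = ∑_m a n m * x_m`. -/
def matrixOp (a : ℕ+ → ℕ+ → ℂ) (ha : Summable fun q : ℕ+ × ℕ+ => ‖a q.1 q.2‖ ^ 2) :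
    EllTwo →L[ℂ] EllTwo :=
  have hrow : ∀ n, Summable fun m => ‖a n m‖ ^ 2 := fun n => ha.prod_factor n
  have hsum : ∀ x : EllTwo,
      Summable fun n => (∑' m, ‖a n m‖ ^ 2) * ‖x‖ ^ 2 := fun x => ha.prod.mul_right _
  have hle : ∀ (x : EllTwo) (n : ℕ+),
      ‖∑' m, a n m * x m‖ ^ 2 ≤ (∑' m, ‖a n m‖ ^ 2) * ‖x‖ ^ 2 :=
    fun x n => norm_tsum_row_sq_le (a n) (hrow n) x
  have hsq : ∀ x : EllTwo, Summable fun n => ‖∑' m, a n m * x m‖ ^ 2 := fun x =>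
    Summable.of_nonneg_of_le (fun _ => by positivity) (hle x) (hsum x)
  LinearMap.mkContinuous
    { toFun := fun x => ⟨fun n => ∑' m, a n m * x m, memℓp_gen (by simpa using hsq x)⟩
      map_add' := fun x y => by
        ext n
        have hx := (inner_conjRow (a n) (hrow n) x).summable
        have hy := (inner_conjRow (a n) (hrow n) y).summable
        simp only [lp.coeFn_add, Pi.add_apply, mul_add]
        exact hx.tsum_add hy
      map_smul' := fun c x => by
        ext n
        simp [mul_left_comm, tsum_mul_left] }
    (Real.sqrt (∑' n, ∑' m, ‖a n m‖ ^ 2))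
    (fun x => by
      refine le_of_sq_le_sq ?_ (by positivity)
      rw [mul_pow, Real.sq_sqrt (tsum_nonneg fun _ => tsum_nonneg fun _ => by positivity),
        ← tsum_mul_right]
      have h := lp.norm_rpow_eq_tsum (p := 2) (by norm_num)
        (⟨fun n => ∑' m, a n m * x m, memℓp_gen (by simpa using hsq x)⟩ : EllTwo)
      simp only [ENNReal.toReal_ofNat, Real.rpow_ofNat] at h
      refine (le_of_eq h).trans ?_
      exact (hsq x).tsum_le_tsum (hle x) (hsum x))

/-- The operator `matrixOp a` acts by matrix multiplication, with convergent sums. -/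
theorem matrixOp_apply (a : ℕ+ → ℕ+ → ℂ) (ha : Summable fun q : ℕ+ × ℕ+ => ‖a q.1 q.2‖ ^ 2)
    (x : EllTwo) (n : ℕ+) : HasSum (fun m => a n m * x m) (matrixOp a ha x n) := by
  have h := inner_conjRow (a n) (ha.prod_factor n) x
  have h2 : matrixOp a ha x n = ∑' m, a n m * x m := rfl
  rw [h2]
  exact h.summable.hasSum

/-- The entries `[n,m]^t / (nm)^((ρ+t)/2)`, where `[n,m]` is the least common multiple. -/
def lcmEntry (ρ t : ℝ) (n m : ℕ+) : ℝ :=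
  ((Nat.lcm n m : ℕ) : ℝ) ^ t / (((n : ℕ) : ℝ) * ((m : ℕ) : ℝ)) ^ ((ρ + t) / 2)

theorem summable_lcmEntry_sq {ρ t : ℝ} (ht : 0 < t) (hρ : t + 1 < ρ) :
    Summable fun q : ℕ+ × ℕ+ => ‖((lcmEntry ρ t q.1 q.2 : ℝ) : ℂ)‖ ^ 2 := by
  have hs : Summable fun n : ℕ+ => ((n : ℕ) : ℝ) ^ (-(ρ - t)) :=
    (Real.summable_nat_rpow.2 (by linarith)).comp_injective PNat.coe_injective
  refine Summable.of_nonneg_of_le (fun _ => by positivity) ?_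
    (hs.mul_of_nonneg hs (fun _ => by positivity) (fun _ => by positivity))
  rintro ⟨n, m⟩
  have hn : (0 : ℝ) < ((n : ℕ) : ℝ) := by exact_mod_cast n.pos
  have hm : (0 : ℝ) < ((m : ℕ) : ℝ) := by exact_mod_cast m.pos
  have hl : ((Nat.lcm n m : ℕ) : ℝ) ≤ ((n : ℕ) : ℝ) * ((m : ℕ) : ℝ) := by
    exact_mod_cast Nat.le_of_dvd (Nat.mul_pos n.pos m.pos) (Nat.lcm_dvd_mul _ _)
  have hnm := mul_pos hn hm
  have h0 : 0 ≤ lcmEntry ρ t n m := by unfold lcmEntry; positivity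
  have h1 : lcmEntry ρ t n m ≤ (((n : ℕ) : ℝ) * ((m : ℕ) : ℝ)) ^ (t - (ρ + t) / 2) := by
    rw [Real.rpow_sub hnm]
    unfold lcmEntry
    gcongr
  simp only [Complex.norm_real, Real.norm_eq_abs, sq_abs]
  calc lcmEntry ρ t n m ^ 2
      ≤ ((((n : ℕ) : ℝ) * ((m : ℕ) : ℝ)) ^ (t - (ρ + t) / 2)) ^ 2 := by gcongr
    _ = ((n : ℕ) : ℝ) ^ (-(ρ - t)) * ((m : ℕ) : ℝ) ^ (-(ρ - t)) := by
        rw [← Real.rpow_natCast, ← Real.rpow_mul hnm.le, ← Real.mul_rpow hn.le hm.le]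
        congr 1
        push_cast
        ring

/-- The operator `E` on `ℓ²(ℕ)` with matrix `[n,m]^t / (nm)^((ρ+t)/2)`. -/
def opE (ρ t : ℝ) (ht : 0 < t) (hρ : t + 1 < ρ) : EllTwo →L[ℂ] EllTwo :=
  matrixOp (fun n m => ((lcmEntry ρ t n m : ℝ) : ℂ)) (summable_lcmEntry_sq ht hρ)

/-- `N((c,∞); A)`: the number of eigenvalues of `A` in `(c,∞)`, counted with multiplicities, i.e.
the dimension of the algebraic span of the corresponding eigenvectors. -/
def eigCount (A : EllTwo →L[ℂ] EllTwo) (c : ℝ) : ℕ∞ :=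
  Cardinal.toENat (Module.rank ℂ
    ↥(⨆ x : Set.Ioi c, Module.End.eigenspace (A : EllTwo →ₗ[ℂ] EllTwo) ((x : ℝ) : ℂ)))

/-- The positive eigenvalues of `A` in non-increasing order, with multiplicities: `posEig A n` is
the `(n+1)`-st largest one. The negative eigenvalues of `A` are `-posEig (-A) n`. -/
def posEig (A : EllTwo →L[ℂ] EllTwo) (n : ℕ) : ℝ :=
  sSup {c : ℝ | 0 < c ∧ (n : ℕ∞) < eigCount A c}

/-- `l` is an infinite non-increasing listing of all positive eigenvalues of `A`, each one
repeated as often as its multiplicity. -/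
structure IsPosEigListing (A : EllTwo →L[ℂ] EllTwo) (l : ℕ → ℝ) : Prop where
  pos : ∀ n, 0 < l n
  antitone : Antitone l
  mult : ∀ c : ℝ, 0 < c → {n | l n = c}.encard =
    Cardinal.toENat (Module.rank ℂ
      ↥(Module.End.eigenspace (A : EllTwo →ₗ[ℂ] EllTwo) (c : ℂ)))

/-- The counting function `#{n : l n > 1/x}` for `x > 0`, extended by `0` to `x ≤ 0`. -/
def countFn (l : ℕ → ℝ) (x : ℝ) : ℝ :=
  if 0 < x then (({n : ℕ | 1 / x < l n}.ncard : ℕ) : ℝ) else 0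

open Classical in
/-- The Lebesgue–Stieltjes measure `dg` of a non-decreasing function `g` on `ℝ`
(with the junk value `0` if `g` is not non-decreasing). -/
def stieltjesMeasure (g : ℝ → ℝ) : Measure ℝ :=
  if hg : Monotone g then hg.stieltjesFunction.measure else 0

/-- The Mellin–Stieltjes transform `∫_0^∞ x^(-s) dg(x)`. -/
def mellinStieltjes (g : ℝ → ℝ) (s : ℂ) : ℂ :=
  ∫ x in Set.Ioi (0 : ℝ), (x : ℂ) ^ (-s) ∂(stieltjesMeasure g)

/-- The integral defining `mellinStieltjes g s` converges absolutely. -/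
def MellinStieltjesConv (g : ℝ → ℝ) (s : ℂ) : Prop :=
  IntegrableOn (fun x : ℝ => (x : ℂ) ^ (-s)) (Set.Ioi (0 : ℝ)) (stieltjesMeasure g)

/-- The transform `∫_0^∞ x^(-s) dμ(x)` of the counting function `μ` of the positive eigenvalues
of `A`. For `A = E` this is `f⁺`, and for `A = -E` it is `f⁻`. -/
def eigTransform (A : EllTwo →L[ℂ] EllTwo) (s : ℂ) : ℂ :=
  mellinStieltjes (countFn (posEig A)) s

/-- `f = f⁺ + f⁻`. -/
def fSum (A : EllTwo →L[ℂ] EllTwo) (s : ℂ) : ℂ := eigTransform A s + eigTransform (-A) s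

/-- `h = f⁺ - f⁻`. -/
def hDiff (A : EllTwo →L[ℂ] EllTwo) (s : ℂ) : ℂ := eigTransform A s - eigTransform (-A) s

end

/-! ### Expanding an infinite product of series into a sum over finitely supported families. -/

section EulerExpansion

open Filter Topology

variable {ι 𝕜 : Type*} [NormedField 𝕜] {g : ι → ℕ → 𝕜}

/-! The matrix of `E` is multiplicative. Writing `n` and `m` through their prime exponents `j`, `k`
and using `max j k = j + k - min j k`, the entry is a product over primes of `β ^ (j + k) * τ ^ min
j k` with `β = p ^ (-(ρ - t) / 2)` and `τ = p ^ (-t)` (`lcmEntry_eq_tensorEntry`). So `E` is an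
infinite tensor product of local operators, and its eigenvalues are the products of local
eigenvalues, one for each prime, all but finitely many being the leading one
(`exists_eigenbasis_opE`).

Each local operator is a rank one operator minus a convergent positive combination of rank one
operators (`localOp_form`). Hence it has exactly one positive eigenvalue, which is `1 + O(β²)`.
Min-max arguments show that the negative ones decay geometrically and that the largest of them in
modulus is `β²(1 + O(β² + τ))` (`exists_isLocalSpectrum`).

Summing `|x| ^ s` and `sgn x * |x| ^ s` over the eigenvalues of `E` therefore gives Euler products
for `f` and `h`, with factors `lam 0 ^ s ± negSum lam s` (`signedPow_euler_product`). With `Q = (β²)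
^ s = p ^ (-(ρ - t) s)` these factors are close to `1 + Q` and `1 - Q`, so multiplying by `1 - Q`,
respectively dividing by it, splits off `ζ((ρ - t)s)`, respectively its inverse. What remains is `1
+ O(β² + β^(2σ) τ + β^(4σ))`, uniformly in `p` and locally in `s` (`exists_bound_euler_factors`).
This is summable over primes for some `σ < 1/(ρ - t)` (`exists_abscissa`), and the corrected
products are analytic for `Re s > σ`.

The other half of the argument passes from a diagonalising basis to `posEig` (`posEig_properties`)
and from its counting function to the Stieltjes integral (`mellinStieltjes_countFn`). -/

theorem summable_prod_graph (hs : ∀ i, Summable fun k => ‖g i k‖)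
    (h1 : Summable fun i => ∑' k, ‖g i (k + 1)‖) :
    Summable fun f : ι →₀ ℕ => ∏ i ∈ f.support, ‖g i (f i)‖ := by
  classical
  -- A family `f` is determined by its graph, a finite set of pairs `(i, k)` with `k ≠ 0`.
  -- Summability of the weights over all pairs thus bounds the sum over finite sets of pairs, of
  -- which graphs are a part.
  have hw : Summable fun x : ι × ℕ => if x.2 = 0 then 0 else ‖g x.1 x.2‖ := by
    have hk : ∀ i, HasSum (fun k => if k = 0 then 0 else ‖g i k‖) (∑' k, ‖g i (k + 1)‖) := by
      intro i
      rw [← hasSum_nat_add_iff' 1]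
      simpa using ((summable_nat_add_iff 1).2 (hs i)).hasSum
    refine (summable_prod_of_nonneg fun x => ?_).2 ⟨fun i => (hk i).summable, ?_⟩
    · dsimp; split_ifs <;> positivity
    · exact h1.congr fun i => (hk i).tsum_eq.symm
  have h := (summable_finsetProd_of_summable_nonneg
    (fun x => by split_ifs <;> positivity) hw).comp_injective (Finsupp.graph_injective ι ℕ)
  refine h.congr fun f => ?_
  simp only [Function.comp, Finsupp.graph, Finset.prod_map]
  exact Finset.prod_congr rfl fun i hi => if_neg (Finsupp.mem_support_iff.1 hi)

/-- The bound does not depend on `S`, which makes it a dominating function for the limit over `S`.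
-/
theorem norm_prod_le_prod_support (h0 : Summable fun i => ‖g i 0 - 1‖) (f : ι →₀ ℕ)
    {S : Finset ι} (hS : f.support ⊆ S) :
    ‖∏ i ∈ S, g i (f i)‖ ≤
      Real.exp (∑' i, ‖g i 0 - 1‖) * ∏ i ∈ f.support, ‖g i (f i)‖ := by
  classical
  have hle : ∀ i, ‖g i (f i)‖ ≤ (1 + ‖g i 0 - 1‖) * if f i = 0 then 1 else ‖g i (f i)‖ := by
    intro i
    split_ifs with h
    · rw [h, mul_one]
      calc ‖g i 0‖ = ‖1 + (g i 0 - 1)‖ := by ring_nf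
        _ ≤ _ := by simpa using norm_add_le (1 : 𝕜) (g i 0 - 1)
    · exact le_mul_of_one_le_left (norm_nonneg _) (by simp)
  rw [norm_prod]
  calc ∏ i ∈ S, ‖g i (f i)‖
      ≤ ∏ i ∈ S, (1 + ‖g i 0 - 1‖) * if f i = 0 then 1 else ‖g i (f i)‖ :=
        Finset.prod_le_prod (fun _ _ => norm_nonneg _) fun i _ => hle i
    _ = (∏ i ∈ S, (1 + ‖g i 0 - 1‖)) * ∏ i ∈ f.support, ‖g i (f i)‖ := by
        rw [Finset.prod_mul_distrib]
        congr 1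
        rw [← Finset.prod_subset hS]
        · exact Finset.prod_congr rfl fun i hi => by rw [if_neg (Finsupp.mem_support_iff.1 hi)]
        · intro i _ hi
          rw [if_pos (Finsupp.notMem_support_iff.1 hi)]
    _ ≤ _ := by
        gcongr
        refine (Real.prod_one_add_le_exp_sum _ fun _ => norm_nonneg _).trans ?_
        exact Real.exp_le_exp.2 (h0.sum_le_tsum _ fun _ _ => norm_nonneg _)

theorem summable_norm_sub_one (h0 : Summable fun i => ‖g i 0 - 1‖) (f : ι →₀ ℕ) :
    Summable fun i => ‖g i (f i) - 1‖ := by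
  refine h0.congr_cofinite ?_
  filter_upwards [f.support.finite_toSet.compl_mem_cofinite] with i hi
  have : f i = 0 := Finsupp.notMem_support_iff.1 hi
  rw [this]

/-- Distributivity for finitely many series, by induction on `S`: `f ↦ (f i, f.erase i)` separates
the new coordinate, and the sum becomes a product of two absolutely convergent sums. -/
theorem hasSum_prod_of_support_subset [CompleteSpace 𝕜] (hs : ∀ i, Summable fun k => ‖g i k‖)
    (S : Finset ι) :
    HasSum (fun f : ι →₀ ℕ => open Classical in
      if f.support ⊆ S then ∏ i ∈ S, g i (f i) else 0) (∏ i ∈ S, ∑' k, g i k) ∧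
    Summable (fun f : ι →₀ ℕ => open Classical in
      ‖if f.support ⊆ S then ∏ i ∈ S, g i (f i) else 0‖) := by
  classical
  induction S using Finset.induction_on with
  | empty =>
    constructor
    · convert hasSum_ite_eq (0 : ι →₀ ℕ) (1 : 𝕜) using 2 with f
      · simp
      · simp
    · refine summable_of_hasFiniteSupport ((Set.finite_singleton (0 : ι →₀ ℕ)).subset ?_)
      intro f hf
      by_contra h
      simp_all
  | insert i S hi ih =>
    obtain ⟨ih1, ih2⟩ := ih
    set F : (ι →₀ ℕ) → 𝕜 := fun f => if f.support ⊆ S then ∏ i ∈ S, g i (f i) else 0 with hF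
    let j : (ι →₀ ℕ) → ℕ × (ι →₀ ℕ) := fun f => (f i, f.erase i)
    have hj : Function.Injective j := by
      intro f f' h
      simp only [j, Prod.mk.injEq] at h
      ext a
      by_cases ha : a = i
      · rw [ha, h.1]
      · rw [← Finsupp.erase_ne (f := f) ha, h.2, Finsupp.erase_ne ha]
    have hcomp : ∀ f, (if f.support ⊆ insert i S then ∏ i ∈ insert i S, g i (f i) else 0) =
        g i (j f).1 * F (j f).2 := by
      intro f
      simp only [j, hF, Finsupp.support_erase, Finset.subset_insert_iff]
      rw [mul_ite, mul_zero]
      refine if_congr Iff.rfl ?_ rfl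
      rw [Finset.prod_insert hi]
      congr 1
      exact Finset.prod_congr rfl fun a ha => by
        rw [Finsupp.erase_ne (by rintro rfl; exact hi ha)]
    -- Pairs missed by `j` have a second component that is nonzero at `i ∉ S`, so `F` kills them.
    have hzero : ∀ x ∉ Set.range j, g i x.1 * F x.2 = 0 := by
      rintro ⟨k, f⟩ hx
      have hfi : f i ≠ 0 := by
        intro h0
        refine hx ⟨f.update i k, ?_⟩
        simp only [j, Finsupp.coe_update, Function.update_self, Prod.mk.injEq, true_and]
        ext a
        by_cases ha : a = i
        · rw [ha, Finsupp.erase_same, h0]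
        · rw [Finsupp.erase_ne ha, Finsupp.coe_update, Function.update_of_ne ha]
      have : ¬ f.support ⊆ S := fun h => hi (h (Finsupp.mem_support_iff.2 hfi))
      simp [hF, this]
    have hsm : Summable fun x : ℕ × (ι →₀ ℕ) => ‖g i x.1 * F x.2‖ := (hs i).mul_norm ih2
    have hsum : HasSum (fun x : ℕ × (ι →₀ ℕ) => g i x.1 * F x.2)
        ((∑' k, g i k) * ∏ i ∈ S, ∑' k, g i k) :=
      (hs i).of_norm.hasSum.mul ih1 hsm.of_norm
    rw [Finset.prod_insert hi]
    simp only [hcomp]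
    exact ⟨(hj.hasSum_iff hzero).2 hsum, hsm.comp_injective hj⟩

/-- Expansion of an infinite product of series. -/
theorem euler_expansion [CompleteSpace 𝕜] (h0 : Summable fun i => ‖g i 0 - 1‖)
    (hs : ∀ i, Summable fun k => ‖g i k‖) (h1 : Summable fun i => ∑' k, ‖g i (k + 1)‖) :
    (∀ f : ι →₀ ℕ, Multipliable fun i => g i (f i)) ∧
    (Summable fun f : ι →₀ ℕ => ‖∏' i, g i (f i)‖) ∧
    (Multipliable fun i => ∑' k, g i k) ∧
    ∑' f : ι →₀ ℕ, ∏' i, g i (f i) = ∏' i, ∑' k, g i k := by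
  classical
  have hm : ∀ f : ι →₀ ℕ, Multipliable fun i => g i (f i) := by
    intro f
    refine (multipliable_one_add_of_summable (summable_norm_sub_one h0 f)).congr fun i => ?_
    ring
  have hW := (summable_prod_graph hs h1).mul_left (Real.exp (∑' i, ‖g i 0 - 1‖))
  have hmt : Multipliable fun i => ∑' k, g i k := by
    have : Summable fun i => ‖∑' k, g i k - 1‖ := by
      refine (h0.add h1).of_nonneg_of_le (fun _ => norm_nonneg _) fun i => ?_
      rw [(hs i).of_norm.tsum_eq_zero_add, add_sub_right_comm]
      refine (norm_add_le _ _).trans ?_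
      gcongr
      exact norm_tsum_le_tsum_norm ((summable_nat_add_iff 1).2 (hs i))
    refine (multipliable_one_add_of_summable this).congr fun i => ?_
    ring
  have hbound : ∀ f : ι →₀ ℕ, ‖∏' i, g i (f i)‖ ≤
      Real.exp (∑' i, ‖g i 0 - 1‖) * ∏ i ∈ f.support, ‖g i (f i)‖ := by
    intro f
    refine le_of_tendsto (Tendsto.norm (hm f).hasProd) ?_
    filter_upwards [eventually_ge_atTop f.support] with S hS
    exact norm_prod_le_prod_support h0 f hS
  refine ⟨hm, hW.of_nonneg_of_le (fun _ => norm_nonneg _) hbound, hmt, ?_⟩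
  -- The finite product over `S` is the sum over `f` supported in `S`; let `S` grow on both sides.
  have ht := tendsto_tsum_of_dominated_convergence (𝓕 := (atTop : Filter (Finset ι)))
    (f := fun S (f : ι →₀ ℕ) => if f.support ⊆ S then ∏ i ∈ S, g i (f i) else 0)
    (g := fun f => ∏' i, g i (f i)) hW
    (fun f => by
      refine Tendsto.congr' ?_ (hm f).hasProd
      filter_upwards [eventually_ge_atTop f.support] with S hS
      rw [if_pos hS])
    (Eventually.of_forall fun S f => by
      split_ifs with h
      · exact norm_prod_le_prod_support h0 f h
      · rw [norm_zero]; positivity)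
  simp only [(hasSum_prod_of_support_subset hs _).1.tsum_eq] at ht
  exact tendsto_nhds_unique ht hmt.hasProd

end EulerExpansion

/-- Positive integers as families of prime exponents. -/
noncomputable def primeExponents : ℕ+ ≃ (Nat.Primes →₀ ℕ) :=
  PNat.factorMultisetEquiv.trans Multiset.toFinsupp.toEquiv

theorem primeExponents_apply (n : ℕ+) (p : Nat.Primes) :
    primeExponents n p = (n : ℕ).factorization p := by
  change Multiset.count p (PNat.factorMultiset n) = _
  refine eq_of_forall_le_iff fun k => ?_
  rw [← p.2.pow_dvd_iff_le_factorization n.ne_zero, ← PNat.count_factorMultiset, PNat.dvd_iff, PNat.pow_coe]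
  rfl

/-! ### Arranging the positive values of a family in non-increasing order. -/

section Listing

variable {ι : Type*} {μ : ι → ℝ}

/-- The values of `μ` in non-increasing order. -/
noncomputable def listing (μ : ι → ℝ) (n : ℕ) : ℝ :=
  sSup {c : ℝ | 0 < c ∧ (n : ℕ∞) < {i | c < μ i}.encard}

theorem exists_gap_above (hfin : ∀ c, 0 < c → {i | c < μ i}.Finite) {c : ℝ} (hc : 0 < c) :
    ∃ d, c < d ∧ ∀ i, c < μ i → d < μ i := by
  rcases {i | c < μ i}.eq_empty_or_nonempty with h | h
  · exact ⟨c + 1, by linarith, fun i hi => absurd (show i ∈ {i | c < μ i} from hi) (by simp [h])⟩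
  · obtain ⟨i₀, h0, h1⟩ := Set.exists_min_image _ μ (hfin c hc) h
    have h0' : c < μ i₀ := h0
    exact ⟨(c + μ i₀) / 2, by linarith, fun i hi => by linarith [h1 i hi]⟩

theorem exists_gap_below (hfin : ∀ c, 0 < c → {i | c < μ i}.Finite) {c : ℝ} (hc : 0 < c) :
    ∃ d, 0 < d ∧ d < c ∧ ∀ i, d < μ i → c ≤ μ i := by
  have hf : {i | c / 2 < μ i ∧ μ i < c}.Finite := (hfin (c / 2) (by linarith)).subset fun i h => h.1
  rcases {i | c / 2 < μ i ∧ μ i < c}.eq_empty_or_nonempty with h | h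
  · refine ⟨c / 2, by linarith, by linarith, fun i hi => ?_⟩
    by_contra hlt
    exact absurd (show i ∈ {i | c / 2 < μ i ∧ μ i < c} from ⟨hi, not_le.1 hlt⟩) (by simp [h])
  · obtain ⟨i₀, h0, h1⟩ := Set.exists_max_image _ μ hf h
    have h0' : c / 2 < μ i₀ ∧ μ i₀ < c := h0
    refine ⟨μ i₀, by linarith, h0'.2, fun i hi => ?_⟩
    by_contra hlt
    exact absurd (h1 i ⟨by linarith, not_le.1 hlt⟩) (not_le.2 hi)

theorem encard_lt_anti {c d : ℝ} (h : c ≤ d) :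
    {i | d < μ i}.encard ≤ {i | c < μ i}.encard :=
  Set.encard_le_encard fun _ hi => lt_of_le_of_lt h hi

theorem bddAbove_listing_set (hfin : ∀ c, 0 < c → {i | c < μ i}.Finite) (n : ℕ) :
    BddAbove {c : ℝ | 0 < c ∧ (n : ℕ∞) < {i | c < μ i}.encard} := by
  obtain ⟨M, hM⟩ := ((hfin 1 one_pos).image μ).bddAbove
  refine ⟨max 1 M, ?_⟩
  rintro c ⟨-, h⟩
  obtain ⟨i, hi⟩ := Set.encard_pos.1 (lt_of_le_of_lt bot_le h)
  have hi' : c < μ i := hi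
  rcases le_or_gt (μ i) 1 with h1 | h1
  · exact le_max_of_le_left (by linarith)
  · exact le_max_of_le_right (hi'.le.trans (hM ⟨i, h1, rfl⟩))

/-- Finiteness leaves a gap above `c`, so a strict count at `c` persists slightly above it and the
supremum exceeds `c` strictly. All other properties of `listing` come from this equivalence. -/
theorem lt_listing_iff (hfin : ∀ c, 0 < c → {i | c < μ i}.Finite) {c : ℝ} (hc : 0 < c) (n : ℕ) :
    c < listing μ n ↔ (n : ℕ∞) < {i | c < μ i}.encard := by
  constructor
  · intro h
    have hne : {c : ℝ | 0 < c ∧ (n : ℕ∞) < {i | c < μ i}.encard}.Nonempty := by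
      by_contra hne
      rw [Set.not_nonempty_iff_eq_empty] at hne
      rw [listing, hne, Real.sSup_empty] at h
      linarith
    obtain ⟨d, hd, hcd⟩ := exists_lt_of_lt_csSup hne h
    exact hd.2.trans_le (encard_lt_anti hcd.le)
  · intro h
    obtain ⟨d, hd, hgap⟩ := exists_gap_above hfin hc
    refine hd.trans_le (le_csSup (bddAbove_listing_set hfin n) ⟨hc.trans hd, h.trans_le ?_⟩)
    exact Set.encard_le_encard hgap

theorem listing_pos (hfin : ∀ c, 0 < c → {i | c < μ i}.Finite) (hinf : {i | 0 < μ i}.Infinite)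
    (n : ℕ) : 0 < listing μ n := by
  obtain ⟨t, ht, hcard⟩ := hinf.exists_subset_card_eq (n + 1)
  have hne : t.Nonempty := Finset.card_pos.1 (by omega)
  obtain ⟨i₀, h0, h1⟩ := t.exists_min_image μ hne
  have hpos : 0 < μ i₀ := ht h0
  refine (half_pos hpos).trans ((lt_listing_iff hfin (half_pos hpos) n).2 ?_)
  have hsub : (t : Set ι) ⊆ {i | μ i₀ / 2 < μ i} := fun i hi => by
    have := h1 i hi
    simp only [Set.mem_ofPred_eq]
    linarith
  refine lt_of_lt_of_le ?_ (Set.encard_le_encard hsub)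
  rw [Set.encard_coe_eq_coe_finsetCard, hcard]
  exact_mod_cast Nat.lt_succ_self n

theorem listing_antitone (hfin : ∀ c, 0 < c → {i | c < μ i}.Finite)
    (hinf : {i | 0 < μ i}.Infinite) : Antitone (listing μ) := by
  intro n m hnm
  refine le_of_forall_lt fun c hc => ?_
  rcases le_or_gt c 0 with h | h
  · exact h.trans_lt (listing_pos hfin hinf n)
  · rw [lt_listing_iff hfin h] at hc ⊢
    exact lt_of_le_of_lt (by exact_mod_cast hnm) hc

theorem encard_setOf_cast_lt (N : ℕ∞) : {n : ℕ | (n : ℕ∞) < N}.encard = N := by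
  induction N using ENat.recTopCoe with
  | top => simp [Set.encard_univ]
  | coe N =>
    have : {n : ℕ | (n : ℕ∞) < N} = (Finset.range N : Set ℕ) := by ext; simp
    rw [this, Set.encard_coe_eq_coe_finsetCard, Finset.card_range]

theorem encard_setOf_lt_listing (hfin : ∀ c, 0 < c → {i | c < μ i}.Finite) {c : ℝ} (hc : 0 < c) :
    {n | c < listing μ n}.encard = {i | c < μ i}.encard := by
  simp only [lt_listing_iff hfin hc]
  exact encard_setOf_cast_lt _

/-- With no value of `μ` in the open interval `(d, c)`, both fibres are differences of the
superlevel sets at `d` and `c`. These have equal cardinalities, and the finite one at `c` cancels.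
-/
theorem encard_listing_fiber (hfin : ∀ c, 0 < c → {i | c < μ i}.Finite) {c : ℝ} (hc : 0 < c) :
    {n | listing μ n = c}.encard = {i | μ i = c}.encard := by
  obtain ⟨d, hd, hdc, hgap⟩ := exists_gap_below hfin hc
  have h1 : {i | μ i = c} = {i | d < μ i} \ {i | c < μ i} := by
    ext i
    simp only [Set.mem_ofPred_eq, Set.mem_sdiff, not_lt]
    exact ⟨fun h => ⟨h ▸ hdc, h.le⟩, fun h => le_antisymm h.2 (hgap i h.1)⟩
  have h2 : {n | listing μ n = c} = {n | d < listing μ n} \ {n | c < listing μ n} := by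
    ext n
    simp only [Set.mem_ofPred_eq, Set.mem_sdiff, not_lt]
    refine ⟨fun h => ⟨h ▸ hdc, h.le⟩, fun h => le_antisymm h.2 (le_of_forall_lt fun x hx => ?_)⟩
    rcases le_or_gt x d with hxd | hxd
    · exact hxd.trans_lt h.1
    · rw [lt_listing_iff hfin (hd.trans hxd)]
      refine ((lt_listing_iff hfin hd n).1 h.1).trans_le (Set.encard_le_encard fun i hi => ?_)
      exact hx.trans_le (hgap i hi)
  have h3 : {i | c < μ i} ⊆ {i | d < μ i} := fun i hi => hdc.trans hi
  have h4 : {n | c < listing μ n} ⊆ {n | d < listing μ n} := fun i hi => hdc.trans hi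
  have e1 := Set.encard_sdiff_add_encard_of_subset h3
  have e2 := Set.encard_sdiff_add_encard_of_subset h4
  rw [← h1] at e1
  rw [← h2, encard_setOf_lt_listing hfin hc, encard_setOf_lt_listing hfin hd, ← e1] at e2
  exact (ENat.add_left_injective_of_ne_top (hfin c hc).encard_lt_top.ne) e2

/-- Fibres over every value are equinumerous, so bijections between them glue. -/
theorem exists_equiv_listing (hfin : ∀ c, 0 < c → {i | c < μ i}.Finite)
    (hinf : {i | 0 < μ i}.Infinite) :
    ∃ e : ℕ ≃ {i // 0 < μ i}, ∀ n, listing μ n = μ (e n) := by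
  have key : ∀ c : ℝ, Nonempty ({n // listing μ n = c} ≃ {i : {i // 0 < μ i} // μ i = c}) := by
    intro c
    rcases le_or_gt c 0 with hc | hc
    · have h1 : IsEmpty {n // listing μ n = c} :=
        ⟨fun n => by linarith [listing_pos hfin hinf n, n.2]⟩
      have h2 : IsEmpty {i : {i // 0 < μ i} // μ i = c} := ⟨fun i => by linarith [i.1.2, i.2]⟩
      exact ⟨Equiv.equivOfIsEmpty _ _⟩
    · have hf : {i | μ i = c}.Finite := by
        obtain ⟨d, hd, hdc, -⟩ := exists_gap_below hfin hc
        exact (hfin d hd).subset fun i hi => by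
          have : μ i = c := hi
          simpa [this] using hdc
      have he := encard_listing_fiber hfin hc
      have hf' : {n | listing μ n = c}.Finite := by
        rw [← Set.encard_lt_top_iff, he]; exact hf.encard_lt_top
      have : Nonempty ({n | listing μ n = c} ≃ {i | μ i = c}) := by
        have := hf.fintype
        have := hf'.fintype
        rw [← Fintype.card_eq, ← Set.toFinset_card, ← Set.toFinset_card]
        rw [Set.encard_eq_coe_toFinset_card, Set.encard_eq_coe_toFinset_card] at he
        exact_mod_cast he
      obtain ⟨e⟩ := this
      refine ⟨e.trans ⟨fun i => ⟨⟨i, ?_⟩, i.2⟩, fun i => ⟨i.1, i.2⟩, fun i => rfl, fun i => rfl⟩⟩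
      have : μ i = c := i.2
      rw [this]; exact hc
  let e : ℕ ≃ {i // 0 < μ i} :=
    Equiv.ofFiberEquiv (f := listing μ) (g := fun i : {i // 0 < μ i} => μ i)
      fun c => (key c).some
  exact ⟨e, fun n => (Equiv.ofFiberEquiv_map (f := listing μ)
    (g := fun i : {i // 0 < μ i} => μ i) (fun c => (key c).some) n).symm⟩

end Listing

/-! ### Eigenvalue counts for an operator diagonal in a Hilbert basis. -/

section Diagonal

variable {ι : Type*} (b : HilbertBasis ι ℂ EllTwo) {A : EllTwo →L[ℂ] EllTwo} {μ : ι → ℝ}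

/-- Both sides are continuous linear in `v` and agree on the basis, so self-adjointness of `A` is
not needed. -/
theorem inner_basis_apply (hA : ∀ i, A (b i) = (μ i : ℂ) • b i) (i : ι) (v : EllTwo) :
    inner ℂ (b i) (A v) = (μ i : ℂ) * inner ℂ (b i) v := by
  have h : (innerSL ℂ (b i)).comp A = (μ i : ℂ) • innerSL ℂ (b i) := by
    refine ContinuousLinearMap.ext_on (s := Set.range b) ?_ ?_
    · rw [dense_iff_closure_eq, ← Submodule.topologicalClosure_coe, b.dense_span]
      rfl
    · rintro _ ⟨j, rfl⟩
      simp only [ContinuousLinearMap.comp_apply, innerSL_apply_apply, hA, inner_smul_right,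
        smul_apply, smul_eq_mul]
      by_cases hij : i = j
      · rw [hij]
      · rw [b.orthonormal.2 hij]; simp
  simpa using DFunLike.congr_fun h v

theorem inner_basis_eq_zero (hA : ∀ i, A (b i) = (μ i : ℂ) • b i) {x : ℝ} {v : EllTwo}
    (hv : v ∈ Module.End.eigenspace (A : EllTwo →ₗ[ℂ] EllTwo) (x : ℂ)) {i : ι} (hi : μ i ≠ x) :
    inner ℂ (b i) v = 0 := by
  have h := inner_basis_apply b hA i v
  rw [Module.End.mem_eigenspace_iff] at hv
  have hv' : A v = (x : ℂ) • v := hv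
  rw [hv', inner_smul_right, ← sub_eq_zero, ← sub_mul, mul_eq_zero] at h
  refine h.resolve_left ?_
  rw [← Complex.ofReal_sub, Complex.ofReal_eq_zero, sub_eq_zero]
  exact hi.symm

/-- Finiteness of `T` turns Hilbert expansions of vectors of `W` into finite sums, so `W` is an
algebraic span of basis vectors. -/
theorem toENat_rank_eq_encard (W : Submodule ℂ EllTwo) {T : Set ι} (hT : T.Finite)
    (h1 : ∀ i ∈ T, b i ∈ W) (h2 : ∀ v ∈ W, ∀ i ∉ T, inner ℂ (b i) v = 0) :
    Cardinal.toENat (Module.rank ℂ ↥W) = T.encard := by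
  have hW : W = Submodule.span ℂ (b '' T) := by
    refine le_antisymm (fun v hv => ?_) (Submodule.span_le.2 ?_)
    · have hs := b.hasSum_repr v
      simp only [b.repr_apply_apply] at hs
      have hv' := hs.unique (hasSum_sum_of_ne_finset_zero (s := hT.toFinset) fun i hi => by
        rw [h2 v hv i (by simpa using hi), zero_smul])
      rw [hv']
      refine Submodule.sum_mem _ fun i hi => Submodule.smul_mem _ _ (Submodule.subset_span ?_)
      exact ⟨i, by simpa using hi, rfl⟩
    · rintro _ ⟨i, hi, rfl⟩
      exact h1 i hi
  have hli := b.orthonormal.linearIndependent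
  have hli' : LinearIndepOn ℂ id (b '' T) := (hli.linearIndepOn_id).mono (Set.image_subset_range _ _)
  rw [hW, rank_span_set hli', Set.toENat_cardinalMk, hli.injective.encard_image]

theorem rank_eigenspace_eq_encard (hA : ∀ i, A (b i) = (μ i : ℂ) • b i) {c : ℝ}
    (hT : {i | μ i = c}.Finite) :
    Cardinal.toENat (Module.rank ℂ
      ↥(Module.End.eigenspace (A : EllTwo →ₗ[ℂ] EllTwo) (c : ℂ))) = {i | μ i = c}.encard := by
  refine toENat_rank_eq_encard b _ hT (fun i hi => ?_) fun v hv i hi => inner_basis_eq_zero b hA hv hi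
  rw [Module.End.mem_eigenspace_iff]
  have hi' : μ i = c := hi
  rw [← hi']
  exact hA i

theorem eigCount_eq_encard (hA : ∀ i, A (b i) = (μ i : ℂ) • b i) {c : ℝ}
    (hT : {i | c < μ i}.Finite) : eigCount A c = {i | c < μ i}.encard := by
  refine toENat_rank_eq_encard b _ hT (fun i hi => ?_) fun v hv i hi => ?_
  · refine Submodule.mem_iSup_of_mem (⟨μ i, hi⟩ : Set.Ioi c) ?_
    rw [Module.End.mem_eigenspace_iff]
    exact hA i
  -- For `μ i ≤ c`, every eigenspace in the supremum is orthogonal to `b i`, hence so is their span.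
  · have hle : (⨆ x : Set.Ioi c, Module.End.eigenspace (A : EllTwo →ₗ[ℂ] EllTwo) ((x : ℝ) : ℂ)) ≤
        LinearMap.ker (innerSL ℂ (b i)).toLinearMap := by
      refine iSup_le fun x w hw => ?_
      refine LinearMap.mem_ker.2 (inner_basis_eq_zero b hA hw fun h => hi ?_)
      rw [Set.mem_ofPred_eq, h]
      exact x.2
    exact LinearMap.mem_ker.1 (hle hv)

theorem posEig_eq_listing (hA : ∀ i, A (b i) = (μ i : ℂ) • b i)
    (hfin : ∀ c, 0 < c → {i | c < μ i}.Finite) : posEig A = listing μ := by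
  funext n
  unfold posEig listing
  congr 1
  ext c
  simp only [Set.mem_ofPred_eq]
  refine and_congr_right fun hc => ?_
  rw [eigCount_eq_encard b hA (hfin c hc)]

theorem isPosEigListing_posEig (hA : ∀ i, A (b i) = (μ i : ℂ) • b i)
    (hfin : ∀ c, 0 < c → {i | c < μ i}.Finite) (hinf : {i | 0 < μ i}.Infinite) :
    IsPosEigListing A (posEig A) := by
  rw [posEig_eq_listing b hA hfin]
  refine ⟨listing_pos hfin hinf, listing_antitone hfin hinf, fun c hc => ?_⟩
  rw [encard_listing_fiber hfin hc, rank_eigenspace_eq_encard b hA]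
  obtain ⟨d, hd, hdc, -⟩ := exists_gap_below hfin hc
  exact (hfin d hd).subset fun i hi => by
    have : μ i = c := hi
    simpa [this] using hdc

end Diagonal

/-! ### The Stieltjes measure of a counting function as a sum of point masses. -/

section Stieltjes

open Filter Topology

variable {r : ℕ → ℝ}

theorem monotone_ncard_lt (hr : ∀ x, {n | r n ≤ x}.Finite) :
    Monotone fun x => (({n | r n < x}.ncard : ℕ) : ℝ) := fun x y hxy => by
  have hy : {n | r n < y}.Finite := (hr y).subset fun n hn => LT.lt.le (show r n < y from hn)
  have hsub : {n | r n < x} ⊆ {n | r n < y} := fun n hn => lt_of_lt_of_le hn hxy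
  exact Nat.cast_le.2 (Set.ncard_le_ncard hsub hy)

theorem rightLim_ncard_lt (hr : ∀ x, {n | r n ≤ x}.Finite) (x : ℝ) :
    Function.rightLim (fun x => (({n | r n < x}.ncard : ℕ) : ℝ)) x =
      (({n | r n ≤ x}.ncard : ℕ) : ℝ) := by
  refine rightLim_eq_of_tendsto (tendsto_const_nhds.congr' ?_)
  -- Only finitely many `r n` lie in `(x, x + 1]`, so the count is constant just to the right of
  -- `x`.
  have h1 : ∀ᶠ y in 𝓝[>] x, ∀ n ∈ {n | r n ≤ x + 1}, x < r n → y < r n := by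
    rw [Filter.eventually_all_finite (hr (x + 1))]
    intro n _
    by_cases h : x < r n
    · filter_upwards [nhdsWithin_le_nhds (Iio_mem_nhds h)] with y hy _ using hy
    · exact Eventually.of_forall fun _ h' => absurd h' h
  filter_upwards [h1, self_mem_nhdsWithin, nhdsWithin_le_nhds (Iio_mem_nhds (lt_add_one x))]
    with y hy hxy hy1
  congr 2
  ext n
  simp only [Set.mem_ofPred_eq]
  refine ⟨fun h => lt_of_le_of_lt h hxy, fun h => ?_⟩
  by_contra hx
  have hy1' : y < x + 1 := hy1
  exact absurd (hy n (show r n ≤ x + 1 by linarith) (not_le.1 hx)) (not_lt.2 h.le)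

/-- Right limits replace `<` by `≤`, so the increment over `(a, b]` counts the `r n` in that
interval; two measures on the line agreeing on these intervals are equal. -/
theorem stieltjesMeasure_ncard_lt (hr : ∀ x, {n | r n ≤ x}.Finite) :
    stieltjesMeasure (fun x => (({n | r n < x}.ncard : ℕ) : ℝ)) =
      Measure.map r Measure.count := by
  rw [stieltjesMeasure, dif_pos (monotone_ncard_lt hr)]
  refine Measure.ext_of_Ioc _ _ fun a b hab => ?_
  rw [StieltjesFunction.measure_Ioc, Monotone.stieltjesFunction_eq, Monotone.stieltjesFunction_eq,
    rightLim_ncard_lt hr, rightLim_ncard_lt hr,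
    Measure.map_apply (measurable_of_countable r) measurableSet_Ioc,
    Measure.count_apply (measurable_of_countable r measurableSet_Ioc)]
  have hsub : {n | r n ≤ a} ⊆ {n | r n ≤ b} := fun n hn => le_trans hn hab.le
  have hpre : r ⁻¹' Set.Ioc a b = {n | r n ≤ b} \ {n | r n ≤ a} := by
    ext n
    simp only [Set.mem_preimage, Set.mem_Ioc, Set.mem_sdiff, Set.mem_ofPred_eq, not_le]
    exact and_comm
  have hfin : ({n | r n ≤ b} \ {n | r n ≤ a}).Finite := (hr b).sdiff
  have hcard := Set.ncard_sdiff_add_ncard_of_subset hsub (hr b)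
  rw [hpre, ← hcard, ← hfin.cast_ncard_eq]
  push_cast
  rw [add_sub_cancel_right, ENNReal.ofReal_natCast]

/-- The value `0` set by hand for `x ≤ 0` is what the count of reciprocals gives there anyway. -/
theorem countFn_eq_ncard {l : ℕ → ℝ} (hl : ∀ n, 0 < l n) :
    countFn l = fun x => (({n | (l n)⁻¹ < x}.ncard : ℕ) : ℝ) := by
  funext x
  unfold countFn
  split_ifs with hx
  · congr 2
    ext n
    simp only [Set.mem_ofPred_eq, one_div]
    exact inv_lt_comm₀ hx (hl n)
  · have : {n | (l n)⁻¹ < x} = ∅ := by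
      ext n
      simp only [Set.mem_ofPred_eq, Set.mem_empty_iff_false, iff_false, not_lt]
      exact (not_lt.1 hx).trans (inv_pos.2 (hl n)).le
    rw [this, Set.ncard_empty, Nat.cast_zero]

variable {l : ℕ → ℝ}

theorem finite_inv_le (hl : ∀ n, 0 < l n) (hfin : ∀ c, 0 < c → {n | c < l n}.Finite) (x : ℝ) :
    {n | (l n)⁻¹ ≤ x}.Finite := by
  have hx : 0 < max x 1 + 1 := by positivity
  refine (hfin (max x 1 + 1)⁻¹ (inv_pos.2 hx)).subset fun n hn => ?_
  have hn' : (l n)⁻¹ ≤ x := hn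
  rw [Set.mem_ofPred_eq, inv_lt_comm₀ hx (hl n)]
  linarith [le_max_left x 1]

theorem monotone_countFn (hl : ∀ n, 0 < l n) (hfin : ∀ c, 0 < c → {n | c < l n}.Finite) :
    Monotone (countFn l) := by
  rw [countFn_eq_ncard hl]
  exact monotone_ncard_lt (finite_inv_le hl hfin)

theorem mellinStieltjes_countFn (hl : ∀ n, 0 < l n) (hfin : ∀ c, 0 < c → {n | c < l n}.Finite)
    {s : ℂ} (hs : Summable fun n => ‖((l n : ℝ) : ℂ) ^ s‖) :
    MellinStieltjesConv (countFn l) s ∧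
      mellinStieltjes (countFn l) s = ∑' n, ((l n : ℝ) : ℂ) ^ s := by
  have hm : Measurable fun n => (l n)⁻¹ := measurable_of_countable _
  have hμ := stieltjesMeasure_ncard_lt (finite_inv_le hl hfin)
  have hrestr : (Measure.map (fun n => (l n)⁻¹) Measure.count).restrict (Set.Ioi 0) =
      Measure.map (fun n => (l n)⁻¹) Measure.count := by
    rw [Measure.restrict_map hm measurableSet_Ioi]
    have : (fun n => (l n)⁻¹) ⁻¹' Set.Ioi 0 = Set.univ :=
      Set.eq_univ_of_forall fun n => inv_pos.2 (hl n)
    rw [this, Measure.restrict_univ]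
  have hf : Measurable fun x : ℝ => (x : ℂ) ^ (-s) := by fun_prop
  -- The inversion rule for complex powers requires an argument different from `π`, which positivity
  -- provides.
  have hval : ∀ n, (((l n)⁻¹ : ℝ) : ℂ) ^ (-s) = ((l n : ℝ) : ℂ) ^ s := by
    intro n
    rw [Complex.ofReal_inv, Complex.inv_cpow, Complex.cpow_neg, inv_inv]
    rw [Complex.arg_ofReal_of_nonneg (hl n).le]
    exact Real.pi_pos.ne
  have hint : Integrable (fun n => ((l n : ℝ) : ℂ) ^ s) Measure.count :=
    integrable_count_iff.2 hs
  rw [countFn_eq_ncard hl]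
  refine ⟨?_, ?_⟩
  · rw [MellinStieltjesConv, IntegrableOn, hμ, hrestr,
      integrable_map_measure hf.aestronglyMeasurable hm.aemeasurable]
    exact hint.congr (Eventually.of_forall fun n => (hval n).symm)
  · rw [mellinStieltjes, hμ, hrestr, integral_map hm.aemeasurable hf.aestronglyMeasurable]
    simp only [hval]
    rw [integral_countable hint]
    simp

end Stieltjes

/-! ### Compact symmetric operators and min-max estimates. -/

section SpectralTheory

open Filter Topology

universe u

variable {H : Type u} [NormedAddCommGroup H] [InnerProductSpace ℝ H]

theorem isCompactOperator_rankOne (x y : H) :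
    IsCompactOperator (InnerProductSpace.rankOne ℝ x y) := by
  rw [InnerProductSpace.rankOne_def']
  have h : IsCompactOperator (innerSL ℝ y) :=
    isCompactOperator_of_locallyCompactSpace_dom (innerSL ℝ y)
  exact h.clm_comp (ContinuousLinearMap.toSpanSingleton ℝ x)

theorem IsCompactOperator.of_hasSum [CompleteSpace H] {α : Type*} {F : α → H →L[ℝ] H}
    {T : H →L[ℝ] H} (hF : ∀ i, IsCompactOperator (F i)) (hT : HasSum F T) :
    IsCompactOperator T := by
  refine isCompactOperator_of_tendsto (F := fun s : Finset α => ∑ i ∈ s, F i) hT ?_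
  refine Eventually.of_forall fun s => ?_
  exact (compactOperator (RingHom.id ℝ) H H).sum_mem fun i _ => hF i

/-- A compact symmetric operator has an orthonormal basis of eigenvectors. -/
theorem exists_hilbertBasis_eigenvectors [CompleteSpace H] {T : H →L[ℝ] H}
    (hc : IsCompactOperator T) (hs : T.IsSymmetric) :
    ∃ (ι : Type u) (b : HilbertBasis ι ℝ H) (μ : ι → ℝ), ∀ i, T (b i) = μ i • b i := by
  have hclosed : ∀ x : ℝ, CompleteSpace (Module.End.eigenspace (T : H →ₗ[ℝ] H) x) := fun x => by
    have : IsClosed (Module.End.eigenspace (T : H →ₗ[ℝ] H) x : Set H) := by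
      have h : (Module.End.eigenspace (T : H →ₗ[ℝ] H) x : Set H) = {v | T v = x • v} := by
        ext v
        exact Module.End.mem_eigenspace_iff
      rw [h]
      exact isClosed_eq T.continuous (continuous_const_smul x)
    exact this.completeSpace_coe
  choose w b hb using fun x : ℝ =>
    exists_hilbertBasis (𝕜 := ℝ) (E := Module.End.eigenspace (T : H →ₗ[ℝ] H) x)
  have hon := (hs.orthogonalFamily_eigenspaces).orthonormal_sigma_orthonormal
    fun x => (b x).orthonormal
  refine ⟨Σ x : ℝ, w x, HilbertBasis.mkOfOrthogonalEqBot hon ?_, fun a => a.1, fun a => ?_⟩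
  -- A vector orthogonal to the chosen bases is orthogonal to each eigenspace, hence zero by the
  -- spectral theorem.
  · have hspec := ContinuousLinearMap.orthogonalComplement_iSup_eigenspaces_eq_bot hc hs
    rw [eq_bot_iff, ← hspec]
    intro v hv
    rw [Submodule.mem_orthogonal] at hv ⊢
    intro u hu
    have hle : (⨆ x, Module.End.eigenspace (T : H →ₗ[ℝ] H) x) ≤
        LinearMap.ker (innerSL ℝ v).toLinearMap := by
      refine iSup_le fun x u hu => LinearMap.mem_ker.2 ?_
      have hsum := ((b x).hasSum_repr ⟨u, hu⟩).mapL
        ((innerSL ℝ v).comp (Module.End.eigenspace (T : H →ₗ[ℝ] H) x).subtypeL)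
      refine hsum.unique ((hasSum_zero).congr_fun ?_)
      intro i
      have := hv _ (Submodule.subset_span (Set.mem_range_self (⟨x, i⟩ : Σ x : ℝ, w x)))
      simp only [map_smul, smul_eq_mul]
      have h2 : inner ℝ v ((b x i : Module.End.eigenspace (T : H →ₗ[ℝ] H) x) : H) = 0 := by
        rw [real_inner_comm]; exact this
      simp [h2]
    rw [real_inner_comm]
    exact LinearMap.mem_ker.1 (hle hu)
  · rw [HilbertBasis.coe_mkOfOrthogonalEqBot]
    exact Module.End.mem_eigenspace_iff.1 (b a.1 a.2).2

variable {ι : Type*} (b : HilbertBasis ι ℝ H) {T : H →L[ℝ] H} {μ : ι → ℝ}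

theorem hasSum_inner_diagonal (hT : ∀ i, T (b i) = μ i • b i) (x y : H) :
    HasSum (fun i => μ i * (inner ℝ (b i) x * inner ℝ (b i) y)) (inner ℝ (T x) y) := by
  have h := ((b.hasSum_repr x).mapL T).mapL (innerSL ℝ y)
  simp only [map_smul, hT, b.repr_apply_apply, innerSL_apply_apply, smul_eq_mul] at h
  rw [real_inner_comm y (T x)]
  refine h.congr_fun fun i => ?_
  rw [real_inner_comm (b i) y]
  ring

theorem hasSum_inner_sq (x : H) : HasSum (fun i => inner ℝ (b i) x ^ 2) (‖x‖ ^ 2) := by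
  have h := b.hasSum_inner_mul_inner x x
  rw [real_inner_self_eq_norm_sq] at h
  refine h.congr_fun fun i => ?_
  rw [real_inner_comm (b i) x, sq]

theorem inner_self_eigenvector (hT : ∀ i, T (b i) = μ i • b i) (i : ι) :
    inner ℝ (T (b i)) (b i) = μ i := by
  rw [hT, real_inner_smul_left, real_inner_self_eq_norm_sq, b.orthonormal.1 i]
  ring

/-- If all `μ i < C`, the sum of `(C - μ i)⟨b i, x⟩²` has non-negative terms and value at most `0`,
which forces `x = 0`. -/
theorem exists_le_eigenvalue (hT : ∀ i, T (b i) = μ i • b i) {x : H} (hx : x ≠ 0) {C : ℝ}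
    (h : C * ‖x‖ ^ 2 ≤ inner ℝ (T x) x) : ∃ i, C ≤ μ i := by
  by_contra! hlt
  have hs := ((hasSum_inner_sq b x).mul_left C).sub (hasSum_inner_diagonal b hT x x)
  have hnn : ∀ i, 0 ≤ C * inner ℝ (b i) x ^ 2 - μ i * (inner ℝ (b i) x * inner ℝ (b i) x) := by
    intro i
    nlinarith [hlt i, mul_nonneg (sub_nonneg.2 (hlt i).le) (sq_nonneg (inner ℝ (b i) x))]
  have h0 : C * ‖x‖ ^ 2 - inner ℝ (T x) x = 0 :=
    le_antisymm (by linarith) (hs.nonneg hnn)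
  rw [h0] at hs
  have hz := (hasSum_zero_iff_of_nonneg hnn).1 hs
  have hz' : ∀ i, inner ℝ (b i) x = 0 := by
    intro i
    have h1 : (C - μ i) * inner ℝ (b i) x ^ 2 = 0 := by
      have := congr_fun hz i
      simp only [Pi.zero_apply] at this
      linarith
    rcases mul_eq_zero.1 h1 with h2 | h2
    · linarith [hlt i]
    · exact pow_eq_zero_iff (two_ne_zero) |>.1 h2
  have hn := (hasSum_inner_sq b x).unique (hasSum_zero.congr_fun fun i => by rw [hz' i]; simp)
  exact hx (norm_eq_zero.1 (pow_eq_zero_iff two_ne_zero |>.1 hn))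

/-- Courant–Fischer: among combinations of `m + 1` eigenvectors with eigenvalue above `C`, some
nonzero one is orthogonal to the `m` vectors `w j`, and its quadratic form is too large. -/
theorem encard_eigenvalues_le (hT : ∀ i, T (b i) = μ i • b i) {m : ℕ} (w : Fin m → H) {C : ℝ}
    (h : ∀ x, (∀ j, inner ℝ (w j) x = 0) → inner ℝ (T x) x ≤ C * ‖x‖ ^ 2) :
    {i | C < μ i}.encard ≤ m := by
  classical
  by_contra! hlt
  have h1 : ((m + 1 : ℕ) : ℕ∞) ≤ {i | C < μ i}.encard := by
    push_cast
    exact Order.add_one_le_of_lt hlt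
  obtain ⟨t, ht, hcard⟩ := Set.exists_subset_encard_eq h1
  have htf : t.Finite := Set.finite_of_encard_eq_coe hcard
  lift t to Finset ι using htf
  rw [Set.encard_coe_eq_coe_finsetCard] at hcard
  have hcard' : t.card = m + 1 := by exact_mod_cast hcard
  let L : (t → ℝ) →ₗ[ℝ] H := Fintype.linearCombination ℝ fun i : t => b i
  let F : (t → ℝ) →ₗ[ℝ] (Fin m → ℝ) :=
    LinearMap.pi fun j => (innerSL ℝ (w j)).toLinearMap ∘ₗ L
  have hker : LinearMap.ker F ≠ ⊥ := by
    refine F.ker_ne_bot_of_finrank_lt ?_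
    simp [hcard']
  obtain ⟨a, ha, ha0⟩ := Submodule.exists_mem_ne_zero_of_ne_bot hker
  have hx : ∀ j, inner ℝ (w j) (L a) = 0 := fun j => by
    have := congr_fun (LinearMap.mem_ker.1 ha) j
    simpa [F] using this
  have hco : ∀ i : t, inner ℝ (b i) (L a) = a i := fun i => by
    simp only [L, Fintype.linearCombination_apply, inner_sum, real_inner_smul_right]
    rw [Finset.sum_eq_single i]
    · rw [real_inner_self_eq_norm_sq, b.orthonormal.1]; ring
    · intro k _ hk
      rw [b.orthonormal.2 fun h => hk (Subtype.ext h.symm), mul_zero]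
    · simp
  have hco' : ∀ i ∉ t, inner ℝ (b i) (L a) = 0 := fun i hi => by
    simp only [L, Fintype.linearCombination_apply, inner_sum, real_inner_smul_right]
    refine Finset.sum_eq_zero fun k _ => ?_
    rw [b.orthonormal.2 fun h => hi (by rw [h]; exact k.2), mul_zero]
  have hs := (hasSum_inner_diagonal b hT (L a) (L a)).sub ((hasSum_inner_sq b (L a)).mul_left C)
  have hnn : ∀ i, 0 ≤ μ i * (inner ℝ (b i) (L a) * inner ℝ (b i) (L a)) -
      C * inner ℝ (b i) (L a) ^ 2 := by
    intro i
    by_cases hi : i ∈ t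
    · have : C < μ i := ht hi
      nlinarith [mul_nonneg (sub_nonneg.2 this.le) (sq_nonneg (inner ℝ (b i) (L a)))]
    · rw [hco' i hi]; simp
  have h0 : inner ℝ (T (L a)) (L a) - C * ‖L a‖ ^ 2 = 0 :=
    le_antisymm (by linarith [h (L a) hx]) (hs.nonneg hnn)
  rw [h0] at hs
  have hz := (hasSum_zero_iff_of_nonneg hnn).1 hs
  refine ha0 (funext fun i => ?_)
  have h1 := congr_fun hz i
  have h2 : C < μ i := ht i.2
  rw [hco i] at h1
  have h3 : (μ i - C) * a i ^ 2 = 0 := by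
    simp only [Pi.zero_apply] at h1
    linarith
  rcases mul_eq_zero.1 h3 with h4 | h4
  · linarith
  · exact pow_eq_zero_iff two_ne_zero |>.1 h4

end SpectralTheory

/-! ### The operator attached to one prime. -/

section LocalModel

open Filter Topology

/-- The real Hilbert space `ℓ²` on `{0, 1, 2, …}`. -/
abbrev SeqSpace : Type := lp (fun _ : ℕ => ℝ) 2

theorem hasSum_seq_inner (x y : SeqSpace) : HasSum (fun k => x k * y k) (inner ℝ x y) := by
  refine (lp.hasSum_inner (𝕜 := ℝ) x y).congr_fun fun k => ?_
  simp [mul_comm]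

/-- The standard basis vectors of `ℓ²`. -/
noncomputable def stdVec (k : ℕ) : SeqSpace := lp.single 2 k (1 : ℝ)

theorem inner_stdVec (k : ℕ) (x : SeqSpace) : inner ℝ (stdVec k) x = x k := by
  rw [stdVec, lp.inner_single_left]
  simp

theorem inner_stdVec' (k : ℕ) (x : SeqSpace) : inner ℝ x (stdVec k) = x k := by
  rw [real_inner_comm, inner_stdVec]

theorem stdVec_apply (k m : ℕ) : stdVec k m = if m = k then 1 else 0 := by
  simp [stdVec, lp.single_apply, Pi.single_apply]

variable {β τ : ℝ}

theorem hasSum_geomVec_sq (h0 : 0 < β) (h1 : β < 1) (i : ℕ) :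
    HasSum (fun k => (if i ≤ k then β ^ (k - i) else 0) ^ 2) (1 - β ^ 2)⁻¹ := by
  have h : HasSum (fun k => (β ^ 2) ^ k) (1 - β ^ 2)⁻¹ :=
    hasSum_geometric_of_lt_one (by positivity) (by nlinarith)
  have hinj : Function.Injective fun k => k + i := add_left_injective i
  refine (hinj.hasSum_iff ?_).1 (h.congr_fun fun k => ?_)
  · intro k hk
    rw [if_neg, zero_pow two_ne_zero]
    exact fun hik => hk ⟨k - i, Nat.sub_add_cancel hik⟩
  · simp [← pow_mul, mul_comm]

/-- The shifted geometric sequence `(0, …, 0, 1, β, β², …)` with `i` zeros. -/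
noncomputable def geomVec (h0 : 0 < β) (h1 : β < 1) (i : ℕ) : SeqSpace :=
  ⟨fun k => if i ≤ k then β ^ (k - i) else 0,
    memℓp_gen (by simpa using (hasSum_geomVec_sq h0 h1 i).summable)⟩

variable (h0 : 0 < β) (h1 : β < 1)

theorem geomVec_apply (i k : ℕ) : geomVec h0 h1 i k = if i ≤ k then β ^ (k - i) else 0 := rfl

theorem norm_geomVec_sq (i : ℕ) : ‖geomVec h0 h1 i‖ ^ 2 = (1 - β ^ 2)⁻¹ := by
  rw [← real_inner_self_eq_norm_sq]
  refine (hasSum_seq_inner _ _).unique ((hasSum_geomVec_sq h0 h1 i).congr_fun fun k => ?_)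
  rw [geomVec_apply, sq]

theorem geomVec_eq (i : ℕ) : geomVec h0 h1 i = stdVec i + β • geomVec h0 h1 (i + 1) := by
  ext k
  simp only [lp.coeFn_add, lp.coeFn_smul, Pi.add_apply, Pi.smul_apply, smul_eq_mul, stdVec_apply,
    geomVec_apply]
  rcases lt_trichotomy k i with h | h | h
  · simp [show ¬ i ≤ k by omega, show k ≠ i by omega, show ¬ i + 1 ≤ k by omega]
  · simp [h]
  · rw [if_pos h.le, if_neg h.ne', if_pos (Nat.succ_le_of_lt h), zero_add, ← pow_succ']
    congr 1
    omega

theorem inner_geomVec_eq (i : ℕ) (x : SeqSpace) :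
    inner ℝ (geomVec h0 h1 i) x = x i + β * inner ℝ (geomVec h0 h1 (i + 1)) x := by
  rw [geomVec_eq, inner_add_left, inner_stdVec, real_inner_smul_left]

theorem inner_geomVec_sq_le (i : ℕ) (x : SeqSpace) :
    inner ℝ (geomVec h0 h1 i) x ^ 2 ≤ (1 - β ^ 2)⁻¹ * ‖x‖ ^ 2 := by
  have h := sq_le_sq' (by linarith [neg_le_of_abs_le (abs_real_inner_le_norm (geomVec h0 h1 i) x)])
    (le_of_abs_le (abs_real_inner_le_norm (geomVec h0 h1 i) x))
  rwa [mul_pow, norm_geomVec_sq] at h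

variable (t0 : 0 < τ) (t1 : τ < 1)

/-- The positive part subtracted from a rank one operator in `localOp`. -/
noncomputable def localDefectTerm (τ : ℝ) (i : ℕ) : SeqSpace →L[ℝ] SeqSpace :=
  ((1 - τ) * β ^ 2 * (β ^ 2 * τ) ^ i) •
    InnerProductSpace.rankOne ℝ (geomVec h0 h1 (i + 1)) (geomVec h0 h1 (i + 1))

theorem ratio_lt_one (h0 : 0 < β) (h1 : β < 1) (t1 : τ < 1) : β ^ 2 * τ < 1 := by
  have : β ^ 2 < 1 := by nlinarith
  nlinarith [mul_pos h0 h0]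

include t0 t1 in
theorem hasSum_localDefect :
    HasSum (localDefectTerm h0 h1 τ) (∑' i, localDefectTerm h0 h1 τ i) := by
  have hg := (summable_geometric_of_lt_one (by positivity : 0 ≤ β ^ 2 * τ)
    (ratio_lt_one h0 h1 t1)).mul_left ((1 - τ) * β ^ 2)
  refine Summable.hasSum (Summable.of_norm ?_)
  refine (hg.mul_right (1 - β ^ 2)⁻¹).congr fun i => ?_
  have hpos : 0 ≤ (1 - τ) * β ^ 2 * (β ^ 2 * τ) ^ i :=
    mul_nonneg (mul_nonneg (by linarith) (by positivity)) (by positivity)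
  rw [localDefectTerm, norm_smul, InnerProductSpace.norm_rankOne, Real.norm_of_nonneg hpos, ← sq,
    norm_geomVec_sq]

/-- The operator with matrix `β ^ (j + k) * τ ^ min j k`. -/
noncomputable def localOp (τ : ℝ) : SeqSpace →L[ℝ] SeqSpace :=
  InnerProductSpace.rankOne ℝ (geomVec h0 h1 0) (geomVec h0 h1 0) - ∑' i, localDefectTerm h0 h1 τ i

include t0 t1 in
-- The defect from the rank one form is a sum of products with positive weights. Symmetry, matrix
-- entries, injectivity and all eigenvalue bounds are read off from this.
theorem localOp_form (x y : SeqSpace) :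
    HasSum (fun i => (1 - τ) * β ^ 2 * (β ^ 2 * τ) ^ i *
        (inner ℝ (geomVec h0 h1 (i + 1)) x * inner ℝ (geomVec h0 h1 (i + 1)) y))
      (inner ℝ (geomVec h0 h1 0) x * inner ℝ (geomVec h0 h1 0) y -
        inner ℝ (localOp h0 h1 τ x) y) := by
  have h := ((hasSum_localDefect h0 h1 t0 t1).mapL
    (ContinuousLinearMap.apply ℝ SeqSpace x)).mapL (innerSL ℝ y)
  simp only [ContinuousLinearMap.apply_apply, innerSL_apply_apply, localDefectTerm,
    smul_apply, InnerProductSpace.rankOne_apply, real_inner_smul_right] at h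
  have e : inner ℝ (geomVec h0 h1 0) x * inner ℝ (geomVec h0 h1 0) y -
      inner ℝ (localOp h0 h1 τ x) y =
      inner ℝ y ((∑' i, localDefectTerm h0 h1 τ i : SeqSpace →L[ℝ] SeqSpace) x) := by
    rw [localOp, sub_apply, inner_sub_left, InnerProductSpace.rankOne_apply,
      real_inner_smul_left, sub_sub_cancel, real_inner_comm]
  rw [e]
  refine h.congr_fun fun i => ?_
  rw [real_inner_comm y]

include t0 t1 in
theorem localOp_symm (x y : SeqSpace) :
    inner ℝ (localOp h0 h1 τ x) y = inner ℝ x (localOp h0 h1 τ y) := by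
  have e1 := localOp_form h0 h1 t0 t1 x y
  have e2 := localOp_form h0 h1 t0 t1 y x
  have := e1.unique (e2.congr_fun fun i => by ring)
  rw [real_inner_comm x (localOp h0 h1 τ y)] at *
  linarith

include t0 t1 in
theorem isCompactOperator_localOp : IsCompactOperator (localOp h0 h1 τ) := by
  refine (isCompactOperator_rankOne _ _).sub ?_
  refine IsCompactOperator.of_hasSum (fun i => ?_) (hasSum_localDefect h0 h1 t0 t1)
  exact (compactOperator (RingHom.id ℝ) SeqSpace SeqSpace).smul_mem _
    (isCompactOperator_rankOne _ _)

include t0 t1 in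
-- Each of the `min j k` surviving defect terms equals `(1 - τ) τ ^ i β ^ (j + k)`, and the
-- geometric sum telescopes to `β ^ (j + k) (1 - τ ^ min j k)`.
theorem localOp_entry (j k : ℕ) :
    localOp h0 h1 τ (stdVec j) k = β ^ (j + k) * τ ^ min j k := by
  have h := localOp_form h0 h1 t0 t1 (stdVec j) (stdVec k)
  simp only [inner_stdVec'] at h
  have h' := h.unique (hasSum_sum_of_ne_finset_zero (s := Finset.range (min j k)) fun i hi => by
    rw [Finset.mem_range, not_lt] at hi
    rcases min_le_iff.1 hi with hi | hi
    · rw [geomVec_apply _ _ _ j, if_neg (by omega)]; simp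
    · rw [geomVec_apply _ _ _ k, if_neg (by omega)]; simp)
  have hterm : ∀ i ∈ Finset.range (min j k), (1 - τ) * β ^ 2 * (β ^ 2 * τ) ^ i *
      (geomVec h0 h1 (i + 1) j * geomVec h0 h1 (i + 1) k) =
      (1 - τ) * τ ^ i * β ^ (j + k) := by
    intro i hi
    rw [Finset.mem_range, lt_min_iff] at hi
    obtain ⟨a, rfl⟩ := Nat.exists_eq_add_of_lt hi.1
    obtain ⟨c, rfl⟩ := Nat.exists_eq_add_of_lt hi.2
    rw [geomVec_apply, geomVec_apply, if_pos (by omega), if_pos (by omega),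
      show i + a + 1 - (i + 1) = a by omega, show i + c + 1 - (i + 1) = c by omega]
    ring
  rw [Finset.sum_congr rfl hterm, ← Finset.sum_mul, ← Finset.mul_sum, mul_neg_geom_sum] at h'
  have hz : geomVec h0 h1 0 j * geomVec h0 h1 0 k = β ^ (j + k) := by
    simp [geomVec_apply, pow_add]
  rw [hz] at h'
  linarith

include t0 t1 in
theorem hasSum_localOp (x : SeqSpace) (k : ℕ) :
    HasSum (fun m => β ^ (k + m) * τ ^ min k m * x m) (localOp h0 h1 τ x k) := by
  rw [← inner_stdVec, ← localOp_symm h0 h1 t0 t1]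
  refine (hasSum_seq_inner _ _).congr_fun fun m => ?_
  rw [localOp_entry h0 h1 t0 t1]

theorem pos_weight (h0 : 0 < β) (t0 : 0 < τ) (t1 : τ < 1) (i : ℕ) :
    0 < (1 - τ) * β ^ 2 * (β ^ 2 * τ) ^ i :=
  mul_pos (mul_pos (by linarith) (by positivity)) (by positivity)

include t0 t1 in
-- Dropping the defect leaves a rank one form: at most one positive eigenvalue, and an upper bound
-- for it.
theorem localOp_form_le (x : SeqSpace) :
    inner ℝ (localOp h0 h1 τ x) x ≤ inner ℝ (geomVec h0 h1 0) x ^ 2 := by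
  have h := (localOp_form h0 h1 t0 t1 x x).nonneg fun i =>
    mul_nonneg (pos_weight h0 t0 t1 i).le (mul_self_nonneg _)
  linarith [sq (inner ℝ (geomVec h0 h1 0) x)]

include t0 t1 in
-- The `m` linear conditions remove the first `m` defect terms; the rest is bounded by a geometric
-- tail. By min-max this gives the decay of the negative eigenvalues.
theorem neg_localOp_form_le (m : ℕ) (x : SeqSpace)
    (hx : ∀ i < m, inner ℝ (geomVec h0 h1 (i + 1)) x = 0) :
    inner ℝ ((-localOp h0 h1 τ) x) x ≤
      (1 - τ) * β ^ 2 * (β ^ 2 * τ) ^ m / ((1 - β ^ 2 * τ) * (1 - β ^ 2)) * ‖x‖ ^ 2 := by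
  have hκ := ratio_lt_one h0 h1 t1
  have hκ' : 0 < 1 - β ^ 2 * τ := by linarith
  have hq : 0 < 1 - β ^ 2 := by nlinarith
  have hg : HasSum (fun i => (1 - τ) * β ^ 2 * (β ^ 2 * τ) ^ (i + m) * ((1 - β ^ 2)⁻¹ * ‖x‖ ^ 2))
      ((1 - τ) * β ^ 2 * (β ^ 2 * τ) ^ m / ((1 - β ^ 2 * τ) * (1 - β ^ 2)) * ‖x‖ ^ 2) := by
    have := ((hasSum_geometric_of_lt_one (by positivity : 0 ≤ β ^ 2 * τ) hκ).mul_left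
      ((1 - τ) * β ^ 2 * (β ^ 2 * τ) ^ m)).mul_right ((1 - β ^ 2)⁻¹ * ‖x‖ ^ 2)
    have e : (1 - τ) * β ^ 2 * (β ^ 2 * τ) ^ m / ((1 - β ^ 2 * τ) * (1 - β ^ 2)) * ‖x‖ ^ 2 =
        (1 - τ) * β ^ 2 * (β ^ 2 * τ) ^ m * (1 - β ^ 2 * τ)⁻¹ * ((1 - β ^ 2)⁻¹ * ‖x‖ ^ 2) := by
      rw [div_eq_mul_inv, mul_inv]
      ring
    rw [e]
    exact this.congr_fun fun i => by rw [pow_add]; ring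
  have hf := localOp_form h0 h1 t0 t1 x x
  rw [← hasSum_nat_add_iff' m] at hf
  rw [Finset.sum_eq_zero fun i hi => by rw [hx i (Finset.mem_range.1 hi)]; simp, sub_zero] at hf
  have hle := hasSum_le (fun i => mul_le_mul_of_nonneg_left
    (by rw [← sq]; exact inner_geomVec_sq_le h0 h1 (i + m + 1) x) (pos_weight h0 t0 t1 (i + m)).le)
    hf hg
  rw [neg_apply, inner_neg_left]
  nlinarith [mul_self_nonneg (inner ℝ (geomVec h0 h1 0) x)]

include t0 t1 in
-- Testing against `stdVec k` gives a triangular system, since `geomVec (i + 1)` vanishes at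
-- coordinates up to `i`. It forces all pairings of `x` with the geometric vectors to be zero, and
-- these pairings recover the coordinates of `x`.
theorem localOp_injective {x : SeqSpace} (hx : localOp h0 h1 τ x = 0) : x = 0 := by
  have key : ∀ n, inner ℝ (geomVec h0 h1 n) x = 0 := by
    have hform : ∀ k, HasSum (fun i => (1 - τ) * β ^ 2 * (β ^ 2 * τ) ^ i *
        (inner ℝ (geomVec h0 h1 (i + 1)) x * geomVec h0 h1 (i + 1) k))
        (inner ℝ (geomVec h0 h1 0) x * geomVec h0 h1 0 k) := fun k => by
      have h := localOp_form h0 h1 t0 t1 x (stdVec k)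
      rw [hx, inner_zero_left, sub_zero] at h
      simpa only [inner_stdVec'] using h
    intro n
    induction n using Nat.strong_induction_on with
    | _ n ih =>
      rcases n with _ | n
      · have h := (hform 0).unique (hasSum_zero.congr_fun fun i => by
          rw [geomVec_apply, if_neg (by omega)]; simp)
        simpa [geomVec_apply] using h
      · have h := (hform (n + 1)).unique (hasSum_single n fun i hi => by
          rcases lt_or_gt_of_ne hi with hi | hi
          · rw [ih (i + 1) (by omega)]; simp
          · rw [geomVec_apply, if_neg (by omega)]; simp)
        rw [ih 0 (by omega)] at h
        simp only [geomVec_apply, le_refl, if_true, Nat.sub_self, pow_zero, mul_one, zero_mul] at h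
        exact (mul_eq_zero.1 h.symm).resolve_left (pos_weight h0 t0 t1 n).ne'
  ext k
  have h := inner_geomVec_eq h0 h1 k x
  rw [key, key, mul_zero, add_zero] at h
  exact h.symm

include t0 t1 in
-- The trial vector is orthogonal to `geomVec 0` and pairs to `1` with `geomVec 1`, so the first
-- defect term alone bounds its form from below.
theorem localOp_trial :
    (1 - τ) * β ^ 2 / (1 + β ^ 2) * ‖stdVec 1 - β • stdVec 0‖ ^ 2 ≤
      inner ℝ ((-localOp h0 h1 τ) (stdVec 1 - β • stdVec 0)) (stdVec 1 - β • stdVec 0) := by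
  set x : SeqSpace := stdVec 1 - β • stdVec 0 with hx
  have hcoord : ∀ y : SeqSpace, inner ℝ y x = y 1 - β * y 0 := fun y => by
    rw [hx, inner_sub_right, real_inner_smul_right, inner_stdVec', inner_stdVec']
  have hnorm : ‖x‖ ^ 2 = 1 + β ^ 2 := by
    rw [← real_inner_self_eq_norm_sq, hcoord, ← inner_stdVec, ← inner_stdVec, hcoord, hcoord]
    simp [stdVec_apply]
    ring
  have hf := localOp_form h0 h1 t0 t1 x x
  have h00 : inner ℝ (geomVec h0 h1 0) x = 0 := by
    rw [hcoord]; simp [geomVec_apply]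
  have h11 : inner ℝ (geomVec h0 h1 1) x = 1 := by
    rw [hcoord]; simp [geomVec_apply]
  have hle := le_hasSum hf 0 fun i _ =>
    mul_nonneg (pos_weight h0 t0 t1 i).le (mul_self_nonneg _)
  rw [h00, zero_add, h11] at hle
  rw [hnorm, div_mul_cancel₀ _ (by positivity), neg_apply, inner_neg_left]
  linarith

end LocalModel

/-! ### Eigenvalues and eigenvectors of the local operator. -/

section LocalSpectrum

open Filter Topology

/-- `V` is an orthogonal matrix whose rows are the eigenvectors of the matrix
`β ^ (j + k) * τ ^ min j k`, and `lam` lists the eigenvalues, the only positive one first. -/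
structure IsLocalSpectrum (β τ : ℝ) (lam : ℕ → ℝ) (V : ℕ → ℕ → ℝ) : Prop where
  row : ∀ j j', HasSum (fun k => V j k * V j' k) (if j = j' then 1 else 0)
  col : ∀ k k', HasSum (fun j => V j k * V j k') (if k = k' then 1 else 0)
  eigen : ∀ j k, HasSum (fun m => β ^ (k + m) * τ ^ min k m * V j m) (lam j * V j k)
  one_le : 1 ≤ lam 0
  le : lam 0 ≤ (1 - β ^ 2)⁻¹
  pos : 0 < V 0 0
  one_le_mul_sq : 1 ≤ lam 0 * V 0 0 ^ 2
  neg : ∀ k, lam (k + 1) < 0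
  first : (1 - τ) * β ^ 2 / (1 + β ^ 2) ≤ -lam 1
  decay : ∀ k, -lam (k + 1) ≤
    (1 - τ) * β ^ 2 * (β ^ 2 * τ) ^ k / ((1 - β ^ 2 * τ) * (1 - β ^ 2))

theorem infinite_index_hilbertBasis {ι : Type*} (b : HilbertBasis ι ℝ SeqSpace) : Infinite ι := by
  by_contra h
  have : Finite ι := not_infinite_iff_finite.1 h
  have := Fintype.ofFinite ι
  have hfd : FiniteDimensional ℝ SeqSpace := b.toOrthonormalBasis.toBasis.finiteDimensional_of_finite
  have hli := (default : HilbertBasis ℕ ℝ SeqSpace).orthonormal.linearIndependent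
  have := hli.finite
  exact not_finite ℕ

variable {β τ : ℝ} (h0 : 0 < β) (h1 : β < 1) (t0 : 0 < τ) (t1 : τ < 1)

include h0 h1 t0 t1

theorem exists_signed_enumeration {ι : Type*} (b : HilbertBasis ι ℝ SeqSpace) {μ : ι → ℝ}
    (hb : ∀ i, localOp h0 h1 τ (b i) = μ i • b i) :
    ∃ e : ℕ ≃ ι, 1 ≤ μ (e 0) ∧ (∀ k, μ (e (k + 1)) < 0) ∧
      (1 - τ) * β ^ 2 / (1 + β ^ 2) ≤ -μ (e 1) ∧ ∀ k, -μ (e (k + 1)) ≤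
        (1 - τ) * β ^ 2 * (β ^ 2 * τ) ^ k / ((1 - β ^ 2 * τ) * (1 - β ^ 2)) := by
  have hκ := ratio_lt_one h0 h1 t1
  have hκ' : 0 < 1 - β ^ 2 * τ := by linarith
  have hκ0 : 0 < β ^ 2 * τ := by positivity
  have hq : 0 < 1 - β ^ 2 := by nlinarith
  have hτ : 0 < 1 - τ := by linarith
  have hb' : ∀ i, (-localOp h0 h1 τ) (b i) = (-μ i) • b i := fun i => by
    rw [neg_apply, hb, neg_smul]
  have hne : ∀ i, μ i ≠ 0 := fun i hi => by
    have h := hb i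
    rw [hi, zero_smul] at h
    have hz := localOp_injective h0 h1 t0 t1 h
    have := b.orthonormal.1 i
    rw [hz, norm_zero] at this
    exact zero_ne_one this
  -- The `(0, 0)` entry is `1`.
  obtain ⟨i₀, hi₀⟩ : ∃ i, 1 ≤ μ i := by
    refine exists_le_eigenvalue b hb (x := stdVec 0) ?_ ?_
    · intro h
      have := stdVec_apply 0 0
      rw [h] at this
      simp at this
    · rw [← real_inner_self_eq_norm_sq, inner_stdVec, inner_stdVec', localOp_entry h0 h1 t0 t1,
        stdVec_apply]
      simp
  -- The form is non-positive on the hyperplane orthogonal to `geomVec 0`.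
  have huniq : ∀ i, 0 < μ i → i = i₀ := by
    have hle := encard_eigenvalues_le b hb (m := 1) (fun _ => geomVec h0 h1 0) (C := 0)
      fun x hx => by
        have := localOp_form_le h0 h1 t0 t1 x
        rw [hx 0] at this
        simpa using this
    intro i hi
    exact Set.encard_le_one_iff.1 hle i i₀ hi (one_pos.trans_le hi₀)
  have hcount : ∀ m : ℕ, {i | (1 - τ) * β ^ 2 * (β ^ 2 * τ) ^ m /
      ((1 - β ^ 2 * τ) * (1 - β ^ 2)) < -μ i}.encard ≤ m := fun m =>
    encard_eigenvalues_le b hb' (fun j : Fin m => geomVec h0 h1 (j + 1)) fun x hx =>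
      neg_localOp_form_le h0 h1 t0 t1 m x fun i hi => hx ⟨i, hi⟩
  have hbound_pos : ∀ m : ℕ, 0 < (1 - τ) * β ^ 2 * (β ^ 2 * τ) ^ m /
      ((1 - β ^ 2 * τ) * (1 - β ^ 2)) := fun m => by positivity
  have hfin : ∀ c, 0 < c → {i | c < -μ i}.Finite := by
    intro c hc
    have ht : Tendsto (fun m : ℕ => (1 - τ) * β ^ 2 * (β ^ 2 * τ) ^ m /
        ((1 - β ^ 2 * τ) * (1 - β ^ 2))) atTop (𝓝 0) := by
      have := ((tendsto_pow_atTop_nhds_zero_of_lt_one hκ0.le hκ).const_mul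
        ((1 - τ) * β ^ 2)).div_const ((1 - β ^ 2 * τ) * (1 - β ^ 2))
      simpa using this
    obtain ⟨m, hm⟩ := (ht.eventually_lt_const hc).exists
    refine (Set.finite_of_encard_le_coe (hcount m)).subset fun i hi => ?_
    exact hm.trans hi
  have hinf : {i | 0 < -μ i}.Infinite := by
    intro hf
    have : Infinite ι := infinite_index_hilbertBasis b
    refine Set.infinite_univ (α := ι) ((hf.insert i₀).subset fun i _ => ?_)
    rcases lt_or_gt_of_ne (hne i) with h | h
    · exact Or.inr (neg_pos.2 h)
    · exact Or.inl (huniq i h)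
  obtain ⟨e, he⟩ := exists_equiv_listing hfin hinf
  -- Index `0` holds the positive eigenvalue; the negative ones follow by decreasing modulus,
  -- shifted by one.
  let g : ℕ → ι := fun k => Nat.casesOn k i₀ fun k => (e k : ι)
  have hg : Function.Bijective g := by
    constructor
    · rintro (_ | j) (_ | k) h
      · rfl
      · have h' : i₀ = e k := h
        have := (e k).2
        rw [← h'] at this
        linarith
      · have h' : (e j : ι) = i₀ := h
        have := (e j).2
        rw [h'] at this
        linarith
      · have h' : (e j : ι) = e k := h
        rw [e.injective (Subtype.ext h')]
    · intro i
      rcases lt_or_gt_of_ne (hne i) with h | h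
      · obtain ⟨k, hk⟩ := e.surjective ⟨i, neg_pos.2 h⟩
        exact ⟨k + 1, congr_arg Subtype.val hk⟩
      · exact ⟨0, (huniq i h).symm⟩
  refine ⟨Equiv.ofBijective g hg, hi₀, fun k => neg_pos.1 (e k).2, ?_, fun k => ?_⟩
  · obtain ⟨i, hi⟩ : ∃ i, (1 - τ) * β ^ 2 / (1 + β ^ 2) ≤ -μ i := by
      refine exists_le_eigenvalue b hb' (x := stdVec 1 - β • stdVec 0) ?_
        (localOp_trial h0 h1 t0 t1)
      intro h
      have h2 := congr_arg (fun y : SeqSpace => inner ℝ (stdVec 1) y) h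
      simp only [inner_sub_right, real_inner_smul_right, inner_stdVec, stdVec_apply,
        inner_zero_right] at h2
      simp at h2
    have hpos : 0 < -μ i := lt_of_lt_of_le (by positivity) hi
    obtain ⟨k, hk⟩ := e.surjective ⟨i, hpos⟩
    have h3 := listing_antitone hfin hinf (Nat.zero_le k)
    rw [he, he, hk] at h3
    exact hi.trans h3
  · change -μ (e k) ≤ _
    rw [← he]
    by_contra! hlt
    rw [lt_listing_iff hfin (hbound_pos k)] at hlt
    exact absurd (hlt.trans_le (hcount k)) (lt_irrefl _)

theorem exists_isLocalSpectrum : ∃ lam V, IsLocalSpectrum β τ lam V := by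
  have hsymm : (localOp h0 h1 τ).IsSymmetric := fun x y => localOp_symm h0 h1 t0 t1 x y
  obtain ⟨ι, b, μ, hb⟩ := exists_hilbertBasis_eigenvectors
    (isCompactOperator_localOp h0 h1 t0 t1) hsymm
  obtain ⟨e, he1, he2, he3, he4⟩ := exists_signed_enumeration h0 h1 t0 t1 b hb
  -- The sign is normalised because the corner entries over all primes must tend to `1` for the
  -- tensor product to converge.
  obtain ⟨ε, hε, hεpos⟩ : ∃ ε : ℝ, ε * ε = 1 ∧ 0 ≤ ε * b (e 0) 0 := by
    rcases le_total 0 (b (e 0) 0) with h | h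
    · exact ⟨1, by norm_num, by linarith⟩
    · exact ⟨-1, by norm_num, by linarith⟩
  -- Expand the `(0, 0)` entry, which is `1`, over the eigenbasis: only the leading eigenvalue
  -- contributes positively.
  have hsq : 1 ≤ μ (e 0) * (ε * b (e 0) 0) ^ 2 := by
    have h := (e.hasSum_iff.2 (hasSum_inner_diagonal b hb (stdVec 0) (stdVec 0)))
    simp only [Function.comp_def, inner_stdVec', localOp_entry h0 h1 t0 t1, add_zero, min_self,
      pow_zero, mul_one] at h
    have hle := hasSum_le (g := fun k => if k = 0 then μ (e 0) * (ε * b (e 0) 0) ^ 2 else 0)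
      (fun k => ?_) h (hasSum_ite_eq 0 _)
    · exact hle
    · rcases k with _ | k
      · rw [if_pos rfl, mul_pow, sq ε, hε, one_mul, sq]
      · rw [if_neg (Nat.succ_ne_zero k)]
        exact mul_nonpos_of_nonpos_of_nonneg (he2 k).le (mul_self_nonneg _)
  refine ⟨fun j => μ (e j), fun j k => ε * b (e j) k, ?_, ?_, ?_, he1, ?_, ?_, hsq, he2, he3, he4⟩
  · intro j j'
    classical
    have h := hasSum_seq_inner (b (e j)) (b (e j'))
    rw [orthonormal_iff_ite.1 b.orthonormal] at h
    simp only [e.injective.eq_iff] at h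
    exact h.congr_fun fun k => by linear_combination (b (e j) k * b (e j') k) * hε
  · intro k k'
    have h := e.hasSum_iff.2 (b.hasSum_inner_mul_inner (stdVec k) (stdVec k'))
    simp only [Function.comp_def, inner_stdVec, inner_stdVec', stdVec_apply,
      eq_comm (a := k')] at h
    exact h.congr_fun fun j => by linear_combination (b (e j) k * b (e j) k') * hε
  · intro j k
    have h := (hasSum_localOp h0 h1 t0 t1 (b (e j)) k).mul_left ε
    have hv : localOp h0 h1 τ (b (e j)) k = μ (e j) * b (e j) k := by rw [hb]; simp
    rw [hv] at h
    rw [mul_left_comm] at h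
    exact h.congr_fun fun m => by ring
  · rw [← inner_self_eigenvector b hb (e 0)]
    refine (localOp_form_le h0 h1 t0 t1 _).trans ((inner_geomVec_sq_le h0 h1 0 _).trans ?_)
    rw [b.orthonormal.1]
    simp
  · refine lt_of_le_of_ne hεpos fun h => ?_
    rw [← h] at hsq
    norm_num at hsq

end LocalSpectrum

/-! ### Infinite tensor products of matrices. -/

section Tensor

open Filter Topology

variable {ι : Type*}

/-- Entries of the infinite tensor product of the matrices `A i`. -/
noncomputable def tensorEntry (A : ι → ℕ → ℕ → ℝ) (f g : ι →₀ ℕ) : ℝ := ∏' i, A i (f i) (g i)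

/-- Conditions under which products of infinite tensor products can be computed factorwise. -/
structure IsTensorable (A : ι → ℕ → ℕ → ℝ) : Prop where
  corner : Summable fun i => |A i 0 0 - 1|
  row : ∀ i j, Summable fun k => A i j k ^ 2
  tail : Summable fun i => ∑' k, A i 0 (k + 1) ^ 2

theorem multipliable_of_summable_sub_one {g : ι → ℝ} (h : Summable fun i => |g i - 1|) :
    Multipliable g := by
  have h' : Summable fun i => ‖g i - 1‖ := h
  refine (multipliable_one_add_of_summable h').congr fun i => ?_
  ring

theorem IsTensorable.multipliable {A : ι → ℕ → ℕ → ℝ} (hA : IsTensorable A) (f g : ι →₀ ℕ) :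
    Multipliable fun i => A i (f i) (g i) := by
  refine multipliable_of_summable_sub_one (hA.corner.congr_cofinite ?_)
  filter_upwards [f.support.finite_toSet.compl_mem_cofinite,
    g.support.finite_toSet.compl_mem_cofinite] with i hi hi'
  rw [Finsupp.notMem_support_iff.1 hi, Finsupp.notMem_support_iff.1 hi']

theorem summable_mul_sub_one {x y : ι → ℝ} (hx : Summable fun i => |x i - 1|)
    (hy : Summable fun i => |y i - 1|) : Summable fun i => |x i * y i - 1| := by
  refine Summable.of_norm_bounded_eventually ((hx.mul_left 2).add hy) ?_
  filter_upwards [hy.tendsto_cofinite_zero.eventually_le_const one_pos] with i hi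
  rw [Real.norm_eq_abs, abs_abs, show x i * y i - 1 = (x i - 1) * y i + (y i - 1) by ring]
  refine (abs_add_le _ _).trans ?_
  rw [abs_mul]
  have hy2 : |y i| ≤ 2 := by
    have := abs_le.1 hi
    exact abs_le.2 ⟨by linarith, by linarith⟩
  nlinarith [abs_nonneg (x i - 1)]

theorem abs_mul_le_sq_add_sq (x y : ℝ) : |x * y| ≤ x ^ 2 + y ^ 2 :=
  abs_le.2 ⟨by nlinarith [sq_nonneg (x + y)], by nlinarith [sq_nonneg (x - y)]⟩

/-- The Euler expansion applies because all but finitely many factors use row `0`, where the corner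
and tail conditions hold. Row orthogonality, column orthogonality and the eigenvalue equation are
all instances. -/
theorem hasSum_tensorEntry_mul {A B : ι → ℕ → ℕ → ℝ} (hA : IsTensorable A) (hB : IsTensorable B)
    (f f' : ι →₀ ℕ) :
    HasSum (fun g => tensorEntry A f g * tensorEntry B f' g)
      (∏' i, ∑' k, A i (f i) k * B i (f' i) k) := by
  have hs : ∀ i j j', Summable fun k => |A i j k * B i j' k| := fun i j j' =>
    ((hA.row i j).add (hB.row i j')).of_nonneg_of_le (fun _ => abs_nonneg _)
      fun k => abs_mul_le_sq_add_sq _ _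
  have h0 : Summable fun i => ‖A i (f i) 0 * B i (f' i) 0 - 1‖ := by
    refine (summable_mul_sub_one hA.corner hB.corner).congr_cofinite ?_
    filter_upwards [f.support.finite_toSet.compl_mem_cofinite,
      f'.support.finite_toSet.compl_mem_cofinite] with i hi hi'
    rw [Finsupp.notMem_support_iff.1 hi, Finsupp.notMem_support_iff.1 hi', Real.norm_eq_abs]
  have h1 : Summable fun i => ∑' k, ‖A i (f i) (k + 1) * B i (f' i) (k + 1)‖ := by
    have : Summable fun i => ∑' k, |A i 0 (k + 1) * B i 0 (k + 1)| := by
      refine (hA.tail.add hB.tail).of_nonneg_of_le (fun _ => tsum_nonneg fun _ => abs_nonneg _)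
        fun i => ?_
      have e1 := (summable_nat_add_iff 1).2 (hA.row i 0)
      have e2 := (summable_nat_add_iff 1).2 (hB.row i 0)
      rw [← e1.tsum_add e2]
      exact ((summable_nat_add_iff 1).2 (hs i 0 0)).tsum_le_tsum
        (fun k => abs_mul_le_sq_add_sq _ _) (e1.add e2)
    refine this.congr_cofinite ?_
    filter_upwards [f.support.finite_toSet.compl_mem_cofinite,
      f'.support.finite_toSet.compl_mem_cofinite] with i hi hi'
    rw [Finsupp.notMem_support_iff.1 hi, Finsupp.notMem_support_iff.1 hi']
    rfl
  obtain ⟨-, e2, -, e4⟩ := euler_expansion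
    (g := fun i k => A i (f i) k * B i (f' i) k) h0 (fun i => hs i _ _) h1
  rw [← e4]
  refine e2.of_norm.hasSum.congr_fun fun g => ?_
  exact ((hA.multipliable f g).tprod_mul (hB.multipliable f' g)).symm

theorem tprod_ite_eq_apply [DecidableEq (ι →₀ ℕ)] (f f' : ι →₀ ℕ) :
    ∏' i, (if f i = f' i then (1 : ℝ) else 0) = if f = f' then 1 else 0 := by
  split_ifs with h
  · simp [h]
  · obtain ⟨i, hi⟩ := DFunLike.ne_iff.1 h
    exact tprod_of_exists_eq_zero ⟨i, if_neg hi⟩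

variable {β τ : ι → ℝ} {lam : ι → ℕ → ℝ} {V : ι → ℕ → ℕ → ℝ}

theorem isTensorable_model (hβ : ∀ i, β i ^ 2 ≤ 1 / 2)
    (t0 : ∀ i, 0 < τ i) (t1 : ∀ i, τ i < 1) (hsum : Summable fun i => β i ^ 2) :
    IsTensorable fun i j k => β i ^ (j + k) * τ i ^ min j k := by
  have hg : ∀ i, HasSum (fun k => (β i ^ 2) ^ k) (1 - β i ^ 2)⁻¹ := fun i =>
    hasSum_geometric_of_lt_one (sq_nonneg _) (by linarith [hβ i])
  refine ⟨by simp, fun i j => ?_, ?_⟩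
  · refine ((hg i).summable.mul_left ((β i ^ 2) ^ j)).of_nonneg_of_le (fun _ => sq_nonneg _)
      fun k => ?_
    rw [mul_pow, ← pow_mul, mul_comm (j + k) 2, pow_mul, pow_add]
    refine mul_le_of_le_one_right (by positivity) ?_
    exact pow_le_one₀ (pow_nonneg (t0 i).le _) (pow_le_one₀ (t0 i).le (t1 i).le)
  · refine (hsum.mul_left 2).of_nonneg_of_le (fun _ => tsum_nonneg fun _ => sq_nonneg _)
      fun i => ?_
    have h : HasSum (fun k => (β i ^ (0 + (k + 1)) * τ i ^ min 0 (k + 1)) ^ 2)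
        (β i ^ 2 * (1 - β i ^ 2)⁻¹) := by
      refine ((hg i).mul_left (β i ^ 2)).congr_fun fun k => ?_
      simp only [zero_le, min_eq_left, pow_zero]
      ring
    rw [h.tsum_eq]
    have : (1 - β i ^ 2)⁻¹ ≤ 2 := by
      rw [inv_le_comm₀ (by linarith [hβ i]) two_pos]
      linarith [hβ i]
    nlinarith [sq_nonneg (β i)]

/-- From `1 ≤ lam 0 * V 0 0 ^ 2` and `lam 0 ≤ (1 - β ^ 2)⁻¹`: the leading eigenvector is nearly
`e₀`. As rows and columns have norm one, the same bound controls their tails. -/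
theorem IsLocalSpectrum.sub_corner_le {β τ : ℝ} {lam : ℕ → ℝ} {V : ℕ → ℕ → ℝ}
    (h : IsLocalSpectrum β τ lam V) (hβ : β ^ 2 ≤ 1 / 2) :
    V 0 0 ≤ 1 ∧ 1 - V 0 0 ^ 2 ≤ β ^ 2 := by
  have h1 : V 0 0 ^ 2 ≤ 1 := by
    have := le_hasSum (h.row 0 0) 0 fun k _ => mul_self_nonneg _
    simpa [sq] using this
  refine ⟨by nlinarith [h.pos], ?_⟩
  have h2 : 1 ≤ (1 - β ^ 2)⁻¹ * V 0 0 ^ 2 :=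
    h.one_le_mul_sq.trans (mul_le_mul_of_nonneg_right h.le (sq_nonneg _))
  rw [inv_mul_eq_div, le_div_iff₀ (by linarith)] at h2
  linarith

theorem isTensorable_rows (hβ : ∀ i, β i ^ 2 ≤ 1 / 2) (hsum : Summable fun i => β i ^ 2)
    (h : ∀ i, IsLocalSpectrum (β i) (τ i) (lam i) (V i)) : IsTensorable V := by
  refine ⟨?_, fun i j => ?_, ?_⟩
  · refine hsum.of_nonneg_of_le (fun _ => abs_nonneg _) fun i => ?_
    obtain ⟨e1, e2⟩ := (h i).sub_corner_le (hβ i)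
    rw [abs_sub_comm, abs_of_nonneg (by linarith)]
    nlinarith [(h i).pos]
  · refine ((h i).row j j).summable.congr fun k => (sq _).symm
  · refine hsum.of_nonneg_of_le (fun _ => tsum_nonneg fun _ => sq_nonneg _) fun i => ?_
    obtain ⟨e1, e2⟩ := (h i).sub_corner_le (hβ i)
    have hs := (h i).row 0 0
    rw [← hasSum_nat_add_iff' 1] at hs
    simp only [← sq, if_true, Finset.sum_range_one] at hs
    rw [hs.tsum_eq]
    exact e2

theorem isTensorable_cols (hβ : ∀ i, β i ^ 2 ≤ 1 / 2) (hsum : Summable fun i => β i ^ 2)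
    (h : ∀ i, IsLocalSpectrum (β i) (τ i) (lam i) (V i)) :
    IsTensorable fun i j k => V i k j := by
  refine ⟨(isTensorable_rows hβ hsum h).corner, fun i j => ?_, ?_⟩
  · refine ((h i).col j j).summable.congr fun k => (sq _).symm
  · refine hsum.of_nonneg_of_le (fun _ => tsum_nonneg fun _ => sq_nonneg _) fun i => ?_
    obtain ⟨e1, e2⟩ := (h i).sub_corner_le (hβ i)
    have hs := (h i).col 0 0
    rw [← hasSum_nat_add_iff' 1] at hs
    simp only [← sq, if_true, Finset.sum_range_one] at hs
    rw [hs.tsum_eq]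
    exact e2

theorem IsLocalSpectrum.lam_zero_sub_one_le {β τ : ℝ} {lam : ℕ → ℝ} {V : ℕ → ℕ → ℝ}
    (h : IsLocalSpectrum β τ lam V) (hβ : β ^ 2 ≤ 1 / 2) : lam 0 - 1 ≤ 2 * β ^ 2 := by
  have h1 : (1 - β ^ 2)⁻¹ ≤ 1 + 2 * β ^ 2 := by
    rw [inv_le_iff_one_le_mul₀ (by linarith)]
    nlinarith [sq_nonneg β]
  linarith [h.le]

/-- Eigenvalues of an infinite tensor product. -/
noncomputable def tensorEigenvalue (lam : ι → ℕ → ℝ) (f : ι →₀ ℕ) : ℝ := ∏' i, lam i (f i)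

theorem multipliable_lam (hβ : ∀ i, β i ^ 2 ≤ 1 / 2) (hsum : Summable fun i => β i ^ 2)
    (h : ∀ i, IsLocalSpectrum (β i) (τ i) (lam i) (V i)) (f : ι →₀ ℕ) :
    Multipliable fun i => lam i (f i) := by
  have : Summable fun i => |lam i 0 - 1| := by
    refine (hsum.mul_left 2).of_nonneg_of_le (fun _ => abs_nonneg _) fun i => ?_
    rw [abs_of_nonneg (by linarith [(h i).one_le])]
    exact (h i).lam_zero_sub_one_le (hβ i)
  refine multipliable_of_summable_sub_one (this.congr_cofinite ?_)
  filter_upwards [f.support.finite_toSet.compl_mem_cofinite] with i hi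
  rw [Finsupp.notMem_support_iff.1 hi]

theorem hasSum_tensor_rows [DecidableEq (ι →₀ ℕ)] (hβ : ∀ i, β i ^ 2 ≤ 1 / 2)
    (hsum : Summable fun i => β i ^ 2)
    (h : ∀ i, IsLocalSpectrum (β i) (τ i) (lam i) (V i)) (f f' : ι →₀ ℕ) :
    HasSum (fun g => tensorEntry V f g * tensorEntry V f' g) (if f = f' then 1 else 0) := by
  have ht := isTensorable_rows hβ hsum h
  have := hasSum_tensorEntry_mul ht ht f f'
  simpa only [((h _).row _ _).tsum_eq, tprod_ite_eq_apply] using this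

theorem hasSum_tensor_cols [DecidableEq (ι →₀ ℕ)] (hβ : ∀ i, β i ^ 2 ≤ 1 / 2)
    (hsum : Summable fun i => β i ^ 2)
    (h : ∀ i, IsLocalSpectrum (β i) (τ i) (lam i) (V i)) (g g' : ι →₀ ℕ) :
    HasSum (fun f => tensorEntry V f g * tensorEntry V f g') (if g = g' then 1 else 0) := by
  have ht := isTensorable_cols hβ hsum h
  have := hasSum_tensorEntry_mul ht ht g g'
  simp only [((h _).col _ _).tsum_eq, tprod_ite_eq_apply] at this
  exact this

theorem hasSum_tensor_eigen (hβ : ∀ i, β i ^ 2 ≤ 1 / 2)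
    (t0 : ∀ i, 0 < τ i) (t1 : ∀ i, τ i < 1) (hsum : Summable fun i => β i ^ 2)
    (h : ∀ i, IsLocalSpectrum (β i) (τ i) (lam i) (V i)) (f g : ι →₀ ℕ) :
    HasSum (fun m => tensorEntry (fun i j k => β i ^ (j + k) * τ i ^ min j k) g m *
      tensorEntry V f m) (tensorEigenvalue lam f * tensorEntry V f g) := by
  have ht := isTensorable_rows hβ hsum h
  have := hasSum_tensorEntry_mul (isTensorable_model hβ t0 t1 hsum) ht g f
  simp only [((h _).eigen _ _).tsum_eq] at this
  rwa [(multipliable_lam hβ hsum h f).tprod_mul (ht.multipliable f g)] at this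

end Tensor

/-! ### Factorisation over primes and diagonalisation of `E`. -/

section Global

open Filter Topology

/-- The parameter `p ^ (-(ρ - t) / 2)`. -/
noncomputable def primeβ (ρ t : ℝ) (p : Nat.Primes) : ℝ := ((p : ℕ) : ℝ) ^ (-(ρ - t) / 2)

/-- The parameter `p ^ (-t)`. -/
noncomputable def primeτ (t : ℝ) (p : Nat.Primes) : ℝ := ((p : ℕ) : ℝ) ^ (-t)

variable {ρ t : ℝ}

theorem prime_pos (p : Nat.Primes) : (0 : ℝ) < ((p : ℕ) : ℝ) := by exact_mod_cast p.2.pos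

theorem prime_two_le (p : Nat.Primes) : (2 : ℝ) ≤ ((p : ℕ) : ℝ) := by exact_mod_cast p.2.two_le

theorem primeβ_pos (p : Nat.Primes) : 0 < primeβ ρ t p := Real.rpow_pos_of_pos (prime_pos p) _

theorem primeτ_pos (p : Nat.Primes) : 0 < primeτ t p := Real.rpow_pos_of_pos (prime_pos p) _

theorem primeβ_sq (p : Nat.Primes) : primeβ ρ t p ^ 2 = ((p : ℕ) : ℝ) ^ (-(ρ - t)) := by
  rw [primeβ, ← Real.rpow_natCast, ← Real.rpow_mul (prime_pos p).le]
  congr 1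
  push_cast
  ring

theorem primeβ_sq_le (hρ : t + 1 < ρ) (p : Nat.Primes) : primeβ ρ t p ^ 2 ≤ 1 / 2 := by
  rw [primeβ_sq]
  calc ((p : ℕ) : ℝ) ^ (-(ρ - t)) ≤ ((p : ℕ) : ℝ) ^ (-1 : ℝ) :=
        Real.rpow_le_rpow_of_exponent_le (by linarith [prime_two_le p]) (by linarith)
    _ ≤ 1 / 2 := by
        rw [Real.rpow_neg_one, one_div]
        exact inv_anti₀ two_pos (prime_two_le p)

theorem primeβ_lt_one (hρ : t + 1 < ρ) (p : Nat.Primes) : primeβ ρ t p < 1 := by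
  nlinarith [primeβ_sq_le hρ p, primeβ_pos (ρ := ρ) (t := t) p]

theorem primeτ_lt_one (ht : 0 < t) (p : Nat.Primes) : primeτ t p < 1 :=
  Real.rpow_lt_one_of_one_lt_of_neg (by linarith [prime_two_le p]) (by linarith)

theorem summable_primeβ_sq (hρ : t + 1 < ρ) : Summable fun p => primeβ ρ t p ^ 2 := by
  simp only [primeβ_sq]
  exact Nat.Primes.summable_rpow.2 (by linarith)

theorem hasProd_prime_rpow (n : ℕ+) (x : ℝ) :
    HasProd (fun p : Nat.Primes => ((p : ℕ) : ℝ) ^ (x * ((n : ℕ).factorization p : ℝ)))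
      (((n : ℕ) : ℝ) ^ x) := by
  have hsupp : ∀ k ∉ (n : ℕ).factorization.support,
      (k : ℝ) ^ (x * ((n : ℕ).factorization k : ℝ)) = 1 := fun k hk => by
    rw [Finsupp.notMem_support_iff.1 hk]; simp
  have h := hasProd_prod_of_ne_finset_one (L := SummationFilter.unconditional ℕ) hsupp
  have hval : ∏ k ∈ (n : ℕ).factorization.support,
      (k : ℝ) ^ (x * ((n : ℕ).factorization k : ℝ)) = ((n : ℕ) : ℝ) ^ x := by
    conv_rhs => rw [← Nat.prod_factorization_pow_eq_self n.ne_zero]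
    rw [Finsupp.prod, Nat.cast_prod, ← Real.finsetProd_rpow _ _ fun _ _ => by positivity]
    refine Finset.prod_congr rfl fun k _ => ?_
    rw [mul_comm, Real.rpow_mul (by positivity), Real.rpow_natCast, Nat.cast_pow]
  rw [hval] at h
  refine (hasProd_subtype_iff_of_mulSupport_subset (s := {p | Nat.Prime p}) ?_).2 h
  intro k hk
  by_contra hkp
  refine hk ?_
  change (k : ℝ) ^ (x * ((n : ℕ).factorization k : ℝ)) = 1
  rw [Nat.factorization_eq_zero_of_not_prime _ hkp]
  simp

theorem lcmEntry_eq_tensorEntry (n m : ℕ+) :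
    lcmEntry ρ t n m = tensorEntry
      (fun p j k => primeβ ρ t p ^ (j + k) * primeτ t p ^ min j k)
      (primeExponents n) (primeExponents m) := by
  have h1 := hasProd_prime_rpow (PNat.lcm n m) t
  have h2 := hasProd_prime_rpow (n * m) (-((ρ + t) / 2))
  have h := h1.mul h2
  have hval : lcmEntry ρ t n m =
      ((PNat.lcm n m : ℕ) : ℝ) ^ t * (((n * m : ℕ+) : ℕ) : ℝ) ^ (-((ρ + t) / 2)) := by
    rw [Real.rpow_neg (by positivity), lcmEntry, PNat.lcm_coe, PNat.mul_coe, Nat.cast_mul]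
    rfl
  rw [hval, ← h.tprod_eq, tensorEntry]
  refine tprod_congr fun p => ?_
  rw [primeExponents_apply, primeExponents_apply, PNat.lcm_coe, PNat.mul_coe,
    Nat.factorization_lcm n.ne_zero m.ne_zero, Nat.factorization_mul n.ne_zero m.ne_zero,
    Finsupp.sup_apply, Finsupp.add_apply]
  generalize (n : ℕ).factorization p = j
  generalize (m : ℕ).factorization p = k
  have hp := prime_pos p
  rw [primeβ, primeτ, ← Real.rpow_natCast, ← Real.rpow_natCast, ← Real.rpow_mul hp.le,
    ← Real.rpow_mul hp.le, ← Real.rpow_add hp, ← Real.rpow_add hp]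
  congr 1
  -- This turns the exponent `t max j k - (ρ + t)/2 (j + k)` into `-(ρ - t)/2 (j + k) - t min j k`.
  have : ((j ⊔ k : ℕ) : ℝ) = j + k - (min j k : ℕ) := by
    rw [eq_sub_iff_add_eq]
    have := max_add_min j k
    exact_mod_cast this
  rw [this]
  push_cast
  ring

section OrthogonalMatrix

variable {U : ℕ+ → ℕ+ → ℝ}

/-- The rows of an orthogonal matrix. -/
noncomputable def rowVec (hrow : ∀ n n', HasSum (fun m => U n m * U n' m) (if n = n' then 1 else 0))
    (n : ℕ+) : EllTwo :=
  ⟨fun m => (U n m : ℂ), memℓp_gen (by simpa [sq] using (hrow n n).summable)⟩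

theorem orthonormal_rowVec
    (hrow : ∀ n n', HasSum (fun m => U n m * U n' m) (if n = n' then 1 else 0)) :
    Orthonormal ℂ (rowVec hrow) := by
  rw [orthonormal_iff_ite]
  intro n n'
  have h := lp.hasSum_inner (𝕜 := ℂ) (rowVec hrow n) (rowVec hrow n')
  have h2 := Complex.hasSum_ofReal.2 (hrow n n')
  refine (h.unique (h2.congr_fun fun m => ?_)).trans (by split_ifs <;> simp)
  simp [rowVec, mul_comm]

/-- Row orthogonality gives orthonormality. Column orthogonality writes each standard vector as a
convergent combination of rows, so nothing nonzero is orthogonal to all rows. -/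
theorem exists_hilbertBasis_rowVec
    (hrow : ∀ n n', HasSum (fun m => U n m * U n' m) (if n = n' then 1 else 0))
    (hcol : ∀ m m', HasSum (fun n => U n m * U n m') (if m = m' then 1 else 0)) :
    ∃ b : HilbertBasis ℕ+ ℂ EllTwo, ∀ n, b n = rowVec hrow n := by
  have hon := orthonormal_rowVec hrow
  refine ⟨HilbertBasis.mkOfOrthogonalEqBot hon ?_, fun n => by
    rw [HilbertBasis.coe_mkOfOrthogonalEqBot]⟩
  rw [eq_bot_iff]
  intro x hx
  have hx' : ∀ n, inner ℂ x (rowVec hrow n) = 0 := fun n =>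
    Submodule.inner_left_of_mem_orthogonal (Submodule.subset_span (Set.mem_range_self n)) hx
  rw [Submodule.mem_bot]
  ext m
  have hsum : Summable fun n => ((U n m : ℝ) : ℂ) • rowVec hrow n :=
    (hon.orthogonalFamily.summable_iff_norm_sq_summable fun n => ((U n m : ℝ) : ℂ)).2
      (by simpa [sq] using (hcol m m).summable)
  have hsingle : ∑' n, ((U n m : ℝ) : ℂ) • rowVec hrow n = lp.single 2 m (1 : ℂ) := by
    ext m'
    have h1 := hsum.hasSum.mapL (lp.evalCLM ℂ (fun _ : ℕ+ => ℂ) 2 m')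
    have h2 := Complex.hasSum_ofReal.2 (hcol m m')
    have h3 := h1.unique (h2.congr_fun fun n => by
      rw [Complex.ofReal_mul]; rfl)
    refine h3.trans ?_
    by_cases hm : m = m'
    · subst hm
      simp
    · simp [hm, lp.single_apply, Ne.symm hm]
  have h1 := hsum.hasSum.mapL (innerSL ℂ x)
  have h2 := h1.unique (hasSum_zero.congr_fun fun n => by
    rw [map_smul, innerSL_apply_apply, hx', smul_zero])
  rw [hsingle, innerSL_apply_apply, lp.inner_single_right] at h2
  simpa using h2

end OrthogonalMatrix

theorem exists_tensor_hilbertBasis {lam : Nat.Primes → ℕ → ℝ} {V : Nat.Primes → ℕ → ℕ → ℝ}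
    (hρ : t + 1 < ρ)
    (hV : ∀ p, IsLocalSpectrum (primeβ ρ t p) (primeτ t p) (lam p) (V p)) :
    ∃ b : HilbertBasis ℕ+ ℂ EllTwo, ∀ n m,
      b n m = (tensorEntry V (primeExponents n) (primeExponents m) : ℂ) := by
  classical
  have hβ := primeβ_sq_le (t := t) hρ
  have hsum := summable_primeβ_sq (t := t) hρ
  have hrow : ∀ n n', HasSum (fun m => tensorEntry V (primeExponents n) (primeExponents m) *
      tensorEntry V (primeExponents n') (primeExponents m)) (if n = n' then 1 else 0) := by
    intro n n'
    have h := primeExponents.hasSum_iff.2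
      (hasSum_tensor_rows hβ hsum hV (primeExponents n) (primeExponents n'))
    simpa only [Function.comp_def, primeExponents.injective.eq_iff] using h
  have hcol : ∀ m m', HasSum (fun n => tensorEntry V (primeExponents n) (primeExponents m) *
      tensorEntry V (primeExponents n) (primeExponents m')) (if m = m' then 1 else 0) := by
    intro m m'
    have h := primeExponents.hasSum_iff.2
      (hasSum_tensor_cols hβ hsum hV (primeExponents m) (primeExponents m'))
    simpa only [Function.comp_def, primeExponents.injective.eq_iff] using h
  obtain ⟨b, hb⟩ := exists_hilbertBasis_rowVec hrow hcol
  exact ⟨b, fun n m => by rw [hb]; rfl⟩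

theorem opE_apply_of_tensor {lam : Nat.Primes → ℕ → ℝ} {V : Nat.Primes → ℕ → ℕ → ℝ}
    (ht : 0 < t) (hρ : t + 1 < ρ)
    (hV : ∀ p, IsLocalSpectrum (primeβ ρ t p) (primeτ t p) (lam p) (V p)) (n : ℕ+) (x : EllTwo)
    (hx : ∀ m, x m = (tensorEntry V (primeExponents n) (primeExponents m) : ℂ)) :
    opE ρ t ht hρ x = (tensorEigenvalue lam (primeExponents n) : ℂ) • x := by
  ext k
  have h1 : HasSum (fun m => ((lcmEntry ρ t k m : ℝ) : ℂ) * x m) (opE ρ t ht hρ x k) :=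
    matrixOp_apply (fun n m => ((lcmEntry ρ t n m : ℝ) : ℂ)) _ x k
  have h2 := Complex.hasSum_ofReal.2 (primeExponents.hasSum_iff.2 (hasSum_tensor_eigen
    (primeβ_sq_le hρ) (primeτ_pos (t := t)) (primeτ_lt_one ht) (summable_primeβ_sq hρ) hV
    (primeExponents n) (primeExponents k)))
  have h3 : HasSum (fun m => ((lcmEntry ρ t k m : ℝ) : ℂ) * x m)
      ((tensorEigenvalue lam (primeExponents n) *
        tensorEntry V (primeExponents n) (primeExponents k) : ℝ) : ℂ) := by
    refine h2.congr_fun fun m => ?_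
    rw [lcmEntry_eq_tensorEntry, hx, Function.comp_apply, Complex.ofReal_mul]
  rw [h1.unique h3, Complex.ofReal_mul, ← hx k]
  rfl

theorem exists_eigenbasis_opE (ht : 0 < t) (hρ : t + 1 < ρ) :
    ∃ (lam : Nat.Primes → ℕ → ℝ) (V : Nat.Primes → ℕ → ℕ → ℝ),
      (∀ p, IsLocalSpectrum (primeβ ρ t p) (primeτ t p) (lam p) (V p)) ∧
      ∃ b : HilbertBasis ℕ+ ℂ EllTwo, ∀ n,
        opE ρ t ht hρ (b n) = (tensorEigenvalue lam (primeExponents n) : ℂ) • b n := by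
  choose lam V hV using fun p : Nat.Primes => exists_isLocalSpectrum
    (primeβ_pos (ρ := ρ) (t := t) p) (primeβ_lt_one hρ p) (primeτ_pos (t := t) p)
    (primeτ_lt_one ht p)
  obtain ⟨b, hb⟩ := exists_tensor_hilbertBasis hρ hV
  exact ⟨lam, V, hV, b, fun n => opE_apply_of_tensor ht hρ hV n (b n) (hb n)⟩

end Global

/-! ### Signs of the eigenvalues of the tensor product. -/

section TensorSigns

open Filter Topology

variable {ι : Type*} {β τ : ι → ℝ} {lam : ι → ℕ → ℝ} {V : ι → ℕ → ℕ → ℝ}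

theorem IsLocalSpectrum.lam_zero_pos {β τ : ℝ} {lam : ℕ → ℝ} {V : ℕ → ℕ → ℝ}
    (h : IsLocalSpectrum β τ lam V) : 0 < lam 0 := one_pos.trans_le h.one_le

theorem IsLocalSpectrum.lam_ne_zero {β τ : ℝ} {lam : ℕ → ℝ} {V : ℕ → ℕ → ℝ}
    (h : IsLocalSpectrum β τ lam V) (k : ℕ) : lam k ≠ 0 := by
  rcases k with _ | k
  · exact h.lam_zero_pos.ne'
  · exact (h.neg k).ne

theorem one_le_tensorEigenvalue_zero (hβ : ∀ i, β i ^ 2 ≤ 1 / 2)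
    (hsum : Summable fun i => β i ^ 2) (h : ∀ i, IsLocalSpectrum (β i) (τ i) (lam i) (V i)) :
    1 ≤ tensorEigenvalue lam 0 := by
  refine ge_of_tendsto (multipliable_lam hβ hsum h 0).hasProd (Eventually.of_forall fun s => ?_)
  calc (1 : ℝ) = ∏ i ∈ s, 1 := by simp
    _ ≤ ∏ i ∈ s, lam i ((0 : ι →₀ ℕ) i) :=
      Finset.prod_le_prod (fun _ _ => zero_le_one) fun i _ => (h i).one_le

theorem tensorEigenvalue_add_single (hβ : ∀ i, β i ^ 2 ≤ 1 / 2)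
    (hsum : Summable fun i => β i ^ 2) (h : ∀ i, IsLocalSpectrum (β i) (τ i) (lam i) (V i))
    {f : ι →₀ ℕ} {i : ι} (hi : f i = 0) (k : ℕ) :
    tensorEigenvalue lam (f + Finsupp.single i k) =
      tensorEigenvalue lam f * (lam i k / lam i 0) := by
  classical
  have h1 := (multipliable_lam hβ hsum h f).hasProd
  have h2 := hasProd_ite_eq (L := SummationFilter.unconditional ι) i (lam i k / lam i 0)
  refine HasProd.tprod_eq ((h1.mul h2).congr_fun fun j => ?_)
  by_cases hj : j = i
  · subst hj
    rw [if_pos rfl, Finsupp.add_apply, Finsupp.single_eq_same, hi, zero_add,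
      mul_div_cancel₀ _ (h j).lam_zero_pos.ne']
  · rw [if_neg hj, Finsupp.add_apply, Finsupp.single_eq_of_ne hj, add_zero, mul_one]

/-- Nonzero factors alone do not exclude a vanishing infinite product. Here the product at `f = 0`
is at least `1`, and changing finitely many coordinates multiplies it by nonzero ratios. -/
theorem tensorEigenvalue_ne_zero (hβ : ∀ i, β i ^ 2 ≤ 1 / 2)
    (hsum : Summable fun i => β i ^ 2) (h : ∀ i, IsLocalSpectrum (β i) (τ i) (lam i) (V i))
    (f : ι →₀ ℕ) : tensorEigenvalue lam f ≠ 0 := by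
  induction f using Finsupp.induction with
  | zero => exact (one_pos.trans_le (one_le_tensorEigenvalue_zero hβ hsum h)).ne'
  | single_add i k f hi _ ih =>
    rw [add_comm, tensorEigenvalue_add_single hβ hsum h (Finsupp.notMem_support_iff.1 hi)]
    exact mul_ne_zero ih (div_ne_zero ((h i).lam_ne_zero k) ((h i).lam_ne_zero 0))

theorem infinite_tensorEigenvalue_neg (hβ : ∀ i, β i ^ 2 ≤ 1 / 2)
    (hsum : Summable fun i => β i ^ 2) (h : ∀ i, IsLocalSpectrum (β i) (τ i) (lam i) (V i))
    (i : ι) : {f | 0 < -tensorEigenvalue lam f}.Infinite := by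
  refine Set.infinite_of_injective_forall_mem (f := fun k : ℕ => (0 : ι →₀ ℕ) +
    Finsupp.single i (k + 1)) (fun k l hkl => ?_) fun k => ?_
  · have := DFunLike.congr_fun hkl i
    simpa using this
  · rw [Set.mem_ofPred_eq, tensorEigenvalue_add_single hβ hsum h (by simp), ← mul_neg]
    refine mul_pos (one_pos.trans_le (one_le_tensorEigenvalue_zero hβ hsum h)) ?_
    rw [← neg_div]
    exact div_pos (neg_pos.2 ((h i).neg k)) (h i).lam_zero_pos

/-- Two negative factors at distinct indices make a positive eigenvalue; a single one gives the
negative case. -/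
theorem infinite_tensorEigenvalue_pos (hβ : ∀ i, β i ^ 2 ≤ 1 / 2)
    (hsum : Summable fun i => β i ^ 2) (h : ∀ i, IsLocalSpectrum (β i) (τ i) (lam i) (V i))
    {i j : ι} (hij : i ≠ j) : {f | 0 < tensorEigenvalue lam f}.Infinite := by
  refine Set.infinite_of_injective_forall_mem (f := fun k : ℕ => (0 : ι →₀ ℕ) +
    Finsupp.single i (k + 1) + Finsupp.single j 1) (fun k l hkl => ?_) fun k => ?_
  · have := DFunLike.congr_fun hkl i
    simpa using this
  · rw [Set.mem_ofPred_eq, tensorEigenvalue_add_single hβ hsum h (by simp [hij]),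
      tensorEigenvalue_add_single hβ hsum h (by simp), mul_assoc]
    refine mul_pos (one_pos.trans_le (one_le_tensorEigenvalue_zero hβ hsum h)) ?_
    exact mul_pos_of_neg_of_neg (div_neg_of_neg_of_pos ((h i).neg k) (h i).lam_zero_pos)
      (div_neg_of_neg_of_pos ((h j).neg 0) (h j).lam_zero_pos)

end TensorSigns

/-! ### Multiplicative signed powers. -/

section SignedPower

open Filter Topology

/-- The multiplicative function equal to `x ^ s` for `x > 0` and to `ε * |x| ^ s` otherwise. -/
noncomputable def signedPow (ε s : ℂ) (x : ℝ) : ℂ :=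
  if 0 < x then (x : ℂ) ^ s else ε * ((-x : ℝ) : ℂ) ^ s

variable {ε s : ℂ}

theorem signedPow_of_pos {x : ℝ} (hx : 0 < x) : signedPow ε s x = (x : ℂ) ^ s := if_pos hx

theorem signedPow_of_neg {x : ℝ} (hx : x < 0) : signedPow ε s x = ε * ((-x : ℝ) : ℂ) ^ s :=
  if_neg hx.not_gt

/-- The choices `ε = 1` and `ε = -1` produce `f` and `h` in one argument. -/
theorem signedPow_mul (hε : ε * ε = 1) {x y : ℝ} (hx : x ≠ 0) (hy : y ≠ 0) :
    signedPow ε s (x * y) = signedPow ε s x * signedPow ε s y := by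
  rcases lt_or_gt_of_ne hx with hx | hx <;> rcases lt_or_gt_of_ne hy with hy | hy
  · rw [signedPow_of_pos (mul_pos_of_neg_of_neg hx hy), signedPow_of_neg hx, signedPow_of_neg hy,
      ← neg_mul_neg, Complex.ofReal_mul,
      Complex.mul_cpow_ofReal_nonneg (neg_pos.2 hx).le (neg_pos.2 hy).le]
    linear_combination -(((-x : ℝ) : ℂ) ^ s * ((-y : ℝ) : ℂ) ^ s) * hε
  · rw [signedPow_of_neg (mul_neg_of_neg_of_pos hx hy), signedPow_of_neg hx, signedPow_of_pos hy,
      ← neg_mul, Complex.ofReal_mul, Complex.mul_cpow_ofReal_nonneg (neg_pos.2 hx).le hy.le,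
      mul_assoc]
  · rw [signedPow_of_neg (mul_neg_of_pos_of_neg hx hy), signedPow_of_pos hx, signedPow_of_neg hy,
      ← mul_neg, Complex.ofReal_mul, Complex.mul_cpow_ofReal_nonneg hx.le (neg_pos.2 hy).le]
    ring
  · rw [signedPow_of_pos (mul_pos hx hy), signedPow_of_pos hx, signedPow_of_pos hy,
      Complex.ofReal_mul, Complex.mul_cpow_ofReal_nonneg hx.le hy.le]

theorem continuousAt_signedPow {x : ℝ} (hx : x ≠ 0) : ContinuousAt (signedPow ε s) x := by
  rcases lt_or_gt_of_ne hx with hx | hx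
  · have h : ContinuousAt (fun y : ℝ => ε * ((-y : ℝ) : ℂ) ^ s) x := by
      refine continuousAt_const.mul (ContinuousAt.cpow (by fun_prop) continuousAt_const ?_)
      exact Complex.ofReal_mem_slitPlane.2 (neg_pos.2 hx)
    refine h.congr ?_
    filter_upwards [Iio_mem_nhds hx] with y hy using (signedPow_of_neg hy).symm
  · have h : ContinuousAt (fun y : ℝ => (y : ℂ) ^ s) x := by
      refine ContinuousAt.cpow (by fun_prop) continuousAt_const ?_
      exact Complex.ofReal_mem_slitPlane.2 hx
    refine h.congr ?_
    filter_upwards [Ioi_mem_nhds hx] with y hy using (signedPow_of_pos hy).symm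

theorem signedPow_one : signedPow ε s 1 = 1 := by
  rw [signedPow_of_pos one_pos]; simp

theorem HasProd.signedPow {ι : Type*} {x : ι → ℝ} {a : ℝ} (hε : ε * ε = 1) (hx : ∀ i, x i ≠ 0)
    (ha : a ≠ 0) (h : HasProd x a) : HasProd (fun i => signedPow ε s (x i)) (signedPow ε s a) := by
  have ht := (continuousAt_signedPow (ε := ε) (s := s) ha).tendsto.comp h
  refine Tendsto.congr (fun S => ?_) ht
  simp only [Function.comp_apply]
  induction S using Finset.cons_induction with
  | empty => simp [signedPow_one]
  | cons i S hi ih =>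
    rw [Finset.prod_cons, Finset.prod_cons,
      signedPow_mul hε (hx i) (Finset.prod_ne_zero_iff.2 fun j _ => hx j), ih]

theorem norm_signedPow (hε : ε * ε = 1) {x : ℝ} (hx : x ≠ 0) :
    ‖signedPow ε s x‖ = |x| ^ s.re := by
  have hε' : ‖ε‖ = 1 := by
    have := congr_arg norm hε
    rw [norm_mul, norm_one] at this
    nlinarith [norm_nonneg ε]
  rcases lt_or_gt_of_ne hx with hx | hx
  · rw [signedPow_of_neg hx, norm_mul, hε', one_mul,
      Complex.norm_cpow_eq_rpow_re_of_pos (neg_pos.2 hx), abs_of_neg hx]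
  · rw [signedPow_of_pos hx, Complex.norm_cpow_eq_rpow_re_of_pos hx, abs_of_pos hx]

end SignedPower

/-! ### Bounds for powers of local eigenvalues. -/

section LocalBounds

open Filter Topology

variable {β τ : ℝ} {lam : ℕ → ℝ} {V : ℕ → ℕ → ℝ}

theorem norm_cpow_sub_one_le {x M R : ℝ} {s : ℂ} (hx : 0 < x) (hlog : |Real.log x| ≤ M)
    (hs : ‖s‖ ≤ R) : ‖(x : ℂ) ^ s - 1‖ ≤ R * M * Real.exp (R * M) := by
  have hM : 0 ≤ M := (abs_nonneg _).trans hlog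
  have hR : 0 ≤ R := (norm_nonneg _).trans hs
  have h := Complex.norm_exp_sub_sum_le_norm_mul_exp ((Real.log x : ℂ) * s) 1
  simp only [Finset.sum_range_one, pow_zero, Nat.factorial_zero, Nat.cast_one, div_one,
    pow_one] at h
  rw [Complex.cpow_def_of_ne_zero (by exact_mod_cast hx.ne'), ← Complex.ofReal_log hx.le]
  have hn : ‖(Real.log x : ℂ) * s‖ ≤ R * M := by
    rw [norm_mul, Complex.norm_real, Real.norm_eq_abs, mul_comm]
    gcongr
  refine h.trans ?_
  gcongr

theorem IsLocalSpectrum.abs_log_lam_zero_le (h : IsLocalSpectrum β τ lam V)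
    (hβ : β ^ 2 ≤ 1 / 2) : |Real.log (lam 0)| ≤ 2 * β ^ 2 := by
  rw [abs_of_nonneg (Real.log_nonneg h.one_le)]
  exact (Real.log_le_sub_one_of_pos h.lam_zero_pos).trans (h.lam_zero_sub_one_le hβ)

theorem IsLocalSpectrum.norm_lam_zero_cpow_sub_one_le (h : IsLocalSpectrum β τ lam V)
    (hβ : β ^ 2 ≤ 1 / 2) {R : ℝ} {s : ℂ} (hs : ‖s‖ ≤ R) :
    ‖(lam 0 : ℂ) ^ s - 1‖ ≤ 2 * R * Real.exp R * β ^ 2 := by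
  have hR : 0 ≤ R := (norm_nonneg _).trans hs
  refine (norm_cpow_sub_one_le h.lam_zero_pos (h.abs_log_lam_zero_le hβ) hs).trans ?_
  have : Real.exp (R * (2 * β ^ 2)) ≤ Real.exp R :=
    Real.exp_le_exp.2 (by nlinarith)
  calc R * (2 * β ^ 2) * Real.exp (R * (2 * β ^ 2)) ≤ R * (2 * β ^ 2) * Real.exp R := by gcongr
    _ = _ := by ring

theorem IsLocalSpectrum.neg_lam_le (h : IsLocalSpectrum β τ lam V) (hβ : β ^ 2 ≤ 1 / 2)
    (t0 : 0 < τ) (t1 : τ < 1) (k : ℕ) : -lam (k + 1) ≤ 4 * β ^ 2 * (β ^ 2 * τ) ^ k := by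
  refine (h.decay k).trans ?_
  have hq : 1 / 2 ≤ 1 - β ^ 2 := by linarith
  have hκ : 1 / 2 ≤ 1 - β ^ 2 * τ := by nlinarith [sq_nonneg β]
  have hden : 1 / 4 ≤ (1 - β ^ 2 * τ) * (1 - β ^ 2) := by nlinarith
  have hpow : 0 ≤ β ^ 2 * (β ^ 2 * τ) ^ k := by positivity
  rw [div_le_iff₀ (by linarith)]
  nlinarith [mul_nonneg hpow t0.le, mul_le_mul_of_nonneg_left hden hpow]

theorem IsLocalSpectrum.rpow_neg_lam_le (h : IsLocalSpectrum β τ lam V) (h0 : 0 < β)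
    (hβ : β ^ 2 ≤ 1 / 2) (t0 : 0 < τ) (t1 : τ < 1) {σ σ' R : ℝ} (hσ : 0 < σ) (hσ' : σ ≤ σ')
    (hR : σ' ≤ R) (k : ℕ) :
    (-lam (k + 1)) ^ σ' ≤ 4 ^ R * (β ^ 2) ^ σ * ((β ^ 2) ^ σ) ^ k := by
  have hq : 0 < β ^ 2 := by positivity
  have hle : -lam (k + 1) ≤ 4 * (β ^ 2) ^ (k + 1) := by
    refine (h.neg_lam_le hβ t0 t1 k).trans ?_
    rw [pow_succ' (β ^ 2) k, ← mul_assoc]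
    gcongr
    nlinarith
  calc (-lam (k + 1)) ^ σ' ≤ (4 * (β ^ 2) ^ (k + 1)) ^ σ' :=
        Real.rpow_le_rpow (neg_pos.2 (h.neg k)).le hle (hσ.le.trans hσ')
    _ = 4 ^ σ' * ((β ^ 2) ^ (k + 1)) ^ σ' := Real.mul_rpow (by norm_num) (by positivity)
    _ ≤ 4 ^ R * ((β ^ 2) ^ (k + 1)) ^ σ := by
        refine mul_le_mul (Real.rpow_le_rpow_of_exponent_le (by norm_num) hR) ?_ (by positivity)
          (by positivity)
        exact Real.rpow_le_rpow_of_exponent_ge (by positivity)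
          (pow_le_one₀ hq.le (by linarith)) hσ'
    _ = 4 ^ R * (β ^ 2) ^ σ * ((β ^ 2) ^ σ) ^ k := by
        rw [← Real.rpow_natCast, ← Real.rpow_mul hq.le, mul_comm ((k + 1 : ℕ) : ℝ) σ,
          Real.rpow_mul hq.le, Real.rpow_natCast, pow_succ', mul_assoc]

theorem rpow_le_half {q σ : ℝ} (hq : 0 < q) (hq' : q ≤ 1 / 2) (hσ : 0 < σ) :
    q ^ σ ≤ (1 / 2) ^ σ ∧ (1 / 2 : ℝ) ^ σ < 1 :=
  ⟨Real.rpow_le_rpow hq.le hq' hσ.le, Real.rpow_lt_one (by norm_num) (by norm_num) hσ⟩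

/-- The sum of the powers of the negative eigenvalues. -/
noncomputable def negSum (lam : ℕ → ℝ) (s : ℂ) : ℂ := ∑' k, ((-lam (k + 1) : ℝ) : ℂ) ^ s

theorem IsLocalSpectrum.summable_neg (h : IsLocalSpectrum β τ lam V) (h0 : 0 < β)
    (hβ : β ^ 2 ≤ 1 / 2) (t0 : 0 < τ) (t1 : τ < 1) {s : ℂ} (hs : 0 < s.re) :
    Summable fun k => ‖((-lam (k + 1) : ℝ) : ℂ) ^ s‖ := by
  obtain ⟨e1, e2⟩ := rpow_le_half (by positivity : 0 < β ^ 2) hβ hs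
  refine ((summable_geometric_of_lt_one (by positivity) (e1.trans_lt e2)).mul_left
    (4 ^ s.re * (β ^ 2) ^ s.re)).of_nonneg_of_le (fun _ => norm_nonneg _) fun k => ?_
  rw [Complex.norm_cpow_eq_rpow_re_of_pos (neg_pos.2 (h.neg k))]
  exact h.rpow_neg_lam_le h0 hβ t0 t1 hs le_rfl le_rfl k

/-- The constant is independent of `β` and `τ`. The case `m = 0` bounds the whole sum by
`O(β^(2σ))`, and `m = 1` bounds everything past the first term by `O(β^(4σ))`. -/
theorem IsLocalSpectrum.tsum_norm_tail_le (h : IsLocalSpectrum β τ lam V) (h0 : 0 < β)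
    (hβ : β ^ 2 ≤ 1 / 2) (t0 : 0 < τ) (t1 : τ < 1) {s : ℂ} {σ R : ℝ} (hσ : 0 < σ)
    (hσ' : σ ≤ s.re) (hR : ‖s‖ ≤ R) (m : ℕ) :
    ∑' k, ‖((-lam (k + m + 1) : ℝ) : ℂ) ^ s‖ ≤
      4 ^ R * (1 - (1 / 2 : ℝ) ^ σ)⁻¹ * ((β ^ 2) ^ σ) ^ (m + 1) := by
  obtain ⟨e1, e2⟩ := rpow_le_half (by positivity : 0 < β ^ 2) hβ hσ
  have hs := h.summable_neg h0 hβ t0 t1 (hσ.trans_le hσ')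
  have hg := (hasSum_geometric_of_lt_one (r := (β ^ 2) ^ σ) (by positivity) (e1.trans_lt e2)).mul_left
    (4 ^ R * (β ^ 2) ^ σ * ((β ^ 2) ^ σ) ^ m)
  have hle := ((summable_nat_add_iff m).2 hs).tsum_le_tsum (g := fun k =>
    4 ^ R * (β ^ 2) ^ σ * ((β ^ 2) ^ σ) ^ m * ((β ^ 2) ^ σ) ^ k) (fun k => by
      rw [Complex.norm_cpow_eq_rpow_re_of_pos (neg_pos.2 (h.neg _)), mul_assoc _ (_ ^ m), ← pow_add,
        add_comm m k]
      exact h.rpow_neg_lam_le h0 hβ t0 t1 hσ hσ' ((Complex.re_le_norm s).trans hR) (k + m))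
    hg.summable
  refine hle.trans ?_
  rw [hg.tsum_eq, pow_succ' ((β ^ 2) ^ σ) m]
  have : (1 - (β ^ 2) ^ σ)⁻¹ ≤ (1 - (1 / 2 : ℝ) ^ σ)⁻¹ :=
    inv_anti₀ (by linarith) (by linarith)
  have h3 := mul_le_mul_of_nonneg_left this
    (show 0 ≤ 4 ^ R * ((β ^ 2) ^ σ * ((β ^ 2) ^ σ) ^ m) by positivity)
  linarith

end LocalBounds

/-! ### Local Euler factors compared with those of zeta. -/

section EulerFactors

open Filter Topology

variable {β τ : ℝ} {lam : ℕ → ℝ} {V : ℕ → ℕ → ℝ}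

/-- The trial-vector bound from below and the decay bound at `k = 0` from above pin `-lam 1` to
`β²(1 + O(β² + τ))`. -/
theorem IsLocalSpectrum.abs_log_first_le (h : IsLocalSpectrum β τ lam V) (h0 : 0 < β)
    (hβ : β ^ 2 ≤ 1 / 2) (t0 : 0 < τ) (t1 : τ < 1) :
    |Real.log (-lam 1 / β ^ 2)| ≤ 4 * β ^ 2 + (1 - τ)⁻¹ * τ := by
  have hq : 0 < β ^ 2 := by positivity
  have hq1 : 0 < 1 - β ^ 2 := by linarith
  have hτ : 0 < 1 - τ := by linarith
  have hκ : β ^ 2 * τ ≤ β ^ 2 := by nlinarith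
  have hpos : 0 < -lam 1 / β ^ 2 := div_pos (neg_pos.2 (h.neg 0)) hq
  have hlow : (1 - τ) / (1 + β ^ 2) ≤ -lam 1 / β ^ 2 := by
    rw [le_div_iff₀ hq, div_mul_eq_mul_div]
    exact h.first
  have hup : -lam 1 / β ^ 2 ≤ (1 - β ^ 2)⁻¹ * (1 - β ^ 2)⁻¹ := by
    rw [div_le_iff₀ hq, ← mul_inv, inv_mul_eq_div]
    refine (h.decay 0).trans ?_
    rw [pow_zero, mul_one]
    refine div_le_div₀ hq.le (by nlinarith) (by positivity) ?_
    exact mul_le_mul_of_nonneg_right (by linarith) hq1.le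
  rw [abs_le]
  constructor
  · have h1 := Real.log_le_log (by positivity) hlow
    rw [Real.log_div hτ.ne' (by positivity)] at h1
    have h2 := Real.one_sub_inv_le_log_of_pos hτ
    have h3 : Real.log (1 + β ^ 2) ≤ β ^ 2 := by
      linarith [Real.log_le_sub_one_of_pos (show 0 < 1 + β ^ 2 by positivity)]
    have h4 : 1 - (1 - τ)⁻¹ = -((1 - τ)⁻¹ * τ) := by
      field_simp
      ring
    linarith
  · have h1 := Real.log_le_log hpos hup
    rw [Real.log_mul (by positivity) (by positivity), Real.log_inv] at h1
    have h2 := Real.one_sub_inv_le_log_of_pos hq1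
    have h3 : (1 - β ^ 2)⁻¹ ≤ 1 + 2 * β ^ 2 := by
      rw [inv_le_iff_one_le_mul₀ hq1]
      nlinarith
    have h4 : 0 ≤ (1 - τ)⁻¹ * τ := by positivity
    linarith

theorem norm_cpow_le_of_le_re {q : ℝ} {s : ℂ} {σ : ℝ} (hq : 0 < q) (hq' : q ≤ 1) (hs : σ ≤ s.re) :
    ‖(q : ℂ) ^ s‖ ≤ q ^ σ := by
  rw [Complex.norm_cpow_eq_rpow_re_of_pos hq]
  exact Real.rpow_le_rpow_of_exponent_ge hq hq' hs

theorem IsLocalSpectrum.norm_negSum_le (h : IsLocalSpectrum β τ lam V) (h0 : 0 < β)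
    (hβ : β ^ 2 ≤ 1 / 2) (t0 : 0 < τ) (t1 : τ < 1) {s : ℂ} {σ R : ℝ} (hσ : 0 < σ)
    (hσ' : σ ≤ s.re) (hR : ‖s‖ ≤ R) :
    ‖negSum lam s‖ ≤ 4 ^ R * (1 - (1 / 2 : ℝ) ^ σ)⁻¹ * (β ^ 2) ^ σ := by
  have h1 := h.tsum_norm_tail_le h0 hβ t0 t1 hσ hσ' hR 0
  rw [zero_add, pow_one] at h1
  exact (norm_tsum_le_tsum_norm (h.summable_neg h0 hβ t0 t1 (hσ.trans_le hσ'))).trans h1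

theorem IsLocalSpectrum.norm_negSum_sub_le (h : IsLocalSpectrum β τ lam V) (h0 : 0 < β)
    (hβ : β ^ 2 ≤ 1 / 2) (t0 : 0 < τ) {T : ℝ} (hT : τ ≤ T) (hT1 : T < 1) {s : ℂ} {σ R : ℝ}
    (hσ : 0 < σ) (hσ' : σ ≤ s.re) (hR : ‖s‖ ≤ R) :
    ‖negSum lam s - ((β ^ 2 : ℝ) : ℂ) ^ s‖ ≤
      (β ^ 2) ^ σ * (R * (4 * β ^ 2 + (1 - T)⁻¹ * τ) * Real.exp (R * (2 + (1 - T)⁻¹))) +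
        4 ^ R * (1 - (1 / 2 : ℝ) ^ σ)⁻¹ * ((β ^ 2) ^ σ) ^ 2 := by
  have t1 : τ < 1 := hT.trans_lt hT1
  have hq : 0 < β ^ 2 := by positivity
  have hR0 : 0 ≤ R := (norm_nonneg _).trans hR
  have hT' : 0 < 1 - T := by linarith
  have hs := h.summable_neg h0 hβ t0 t1 (hσ.trans_le hσ')
  have hpos : 0 < -lam 1 := neg_pos.2 (h.neg 0)
  have hlog : |Real.log (-lam 1 / β ^ 2)| ≤ 4 * β ^ 2 + (1 - T)⁻¹ * τ := by
    refine (h.abs_log_first_le h0 hβ t0 t1).trans ?_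
    gcongr
  have hM : 4 * β ^ 2 + (1 - T)⁻¹ * τ ≤ 2 + (1 - T)⁻¹ := by
    have : (1 - T)⁻¹ * τ ≤ (1 - T)⁻¹ := mul_le_of_le_one_right (by positivity) t1.le
    linarith
  have hfirst : ‖((-lam 1 : ℝ) : ℂ) ^ s - ((β ^ 2 : ℝ) : ℂ) ^ s‖ ≤
      (β ^ 2) ^ σ * (R * (4 * β ^ 2 + (1 - T)⁻¹ * τ) * Real.exp (R * (2 + (1 - T)⁻¹))) := by
    have e : ((-lam 1 : ℝ) : ℂ) ^ s =
        ((β ^ 2 : ℝ) : ℂ) ^ s * ((-lam 1 / β ^ 2 : ℝ) : ℂ) ^ s := by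
      rw [← Complex.mul_cpow_ofReal_nonneg hq.le (div_pos hpos hq).le, ← Complex.ofReal_mul,
        mul_div_cancel₀ _ hq.ne']
    rw [e, ← mul_sub_one, norm_mul]
    refine mul_le_mul (norm_cpow_le_of_le_re hq (by linarith) hσ') ?_ (norm_nonneg _)
      (by positivity)
    refine (norm_cpow_sub_one_le (div_pos hpos hq) hlog hR).trans ?_
    gcongr
  have htail := h.tsum_norm_tail_le h0 hβ t0 t1 hσ hσ' hR 1
  have hs1 := (summable_nat_add_iff 1).2 hs
  rw [negSum, hs.of_norm.tsum_eq_zero_add, zero_add, add_sub_right_comm]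
  refine (norm_add_le _ _).trans (add_le_add hfirst ?_)
  exact (norm_tsum_le_tsum_norm hs1).trans htail

theorem euler_factor_bounds {Q L F : ℂ} {a b c δ : ℝ} (hL : ‖L - 1‖ ≤ a) (hF : ‖F - Q‖ ≤ b)
    (hQF : ‖Q * F‖ ≤ c) (hQ : ‖Q‖ ≤ 1 - δ) (hδ : 0 < δ) :
    ‖(1 - Q) * (L + F) - 1‖ ≤ 2 * a + b + c ∧ ‖(1 - Q)⁻¹ * (L - F) - 1‖ ≤ δ⁻¹ * (a + b) := by
  constructor
  · have key : (1 - Q) * (L + F) - 1 = (L - 1) - Q * (L - 1) + (F - Q) - Q * F := by ring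
    have g : ‖Q * (L - 1)‖ ≤ a := by
      rw [norm_mul]
      exact (mul_le_of_le_one_left (norm_nonneg _) (by linarith)).trans hL
    rw [key]
    linarith [norm_sub_le ((L - 1) - Q * (L - 1) + (F - Q)) (Q * F),
      norm_add_le ((L - 1) - Q * (L - 1)) (F - Q), norm_sub_le (L - 1) (Q * (L - 1))]
  · have hQ1 : δ ≤ ‖1 - Q‖ := by
      have := norm_sub_norm_le (1 : ℂ) Q
      rw [norm_one] at this
      linarith
    have hQne : 1 - Q ≠ 0 := norm_pos_iff.1 (hδ.trans_le hQ1)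
    have key : (1 - Q)⁻¹ * (L - F) - 1 = (1 - Q)⁻¹ * ((L - 1) - (F - Q)) := by
      field_simp
      ring
    rw [key, norm_mul, norm_inv]
    refine mul_le_mul (inv_anti₀ hδ hQ1) ?_ (norm_nonneg _) (inv_nonneg.2 hδ.le)
    linarith [norm_sub_le (L - 1) (F - Q)]

/-- One constant serves all local parameters with `τ ≤ T`, so the error can be summed over primes.
-/
theorem exists_bound_euler_factors {σ R T : ℝ} (hσ : 0 < σ) (hR : 0 ≤ R) (hT1 : T < 1) :
    ∃ C, ∀ (β τ : ℝ) (lam : ℕ → ℝ) (V : ℕ → ℕ → ℝ), IsLocalSpectrum β τ lam V → 0 < β →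
      β ^ 2 ≤ 1 / 2 → 0 < τ → τ ≤ T → ∀ s : ℂ, σ ≤ s.re → ‖s‖ ≤ R →
      ‖(1 - ((β ^ 2 : ℝ) : ℂ) ^ s) * ((lam 0 : ℂ) ^ s + negSum lam s) - 1‖ ≤
        C * (β ^ 2 + (β ^ 2) ^ σ * τ + ((β ^ 2) ^ σ) ^ 2) ∧
      ‖(1 - ((β ^ 2 : ℝ) : ℂ) ^ s)⁻¹ * ((lam 0 : ℂ) ^ s - negSum lam s) - 1‖ ≤
        C * (β ^ 2 + (β ^ 2) ^ σ * τ + ((β ^ 2) ^ σ) ^ 2) := by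
  have hδ : 0 < 1 - (1 / 2 : ℝ) ^ σ :=
    sub_pos.2 (Real.rpow_lt_one (by norm_num) (by norm_num) hσ)
  have hT' : 0 < (1 - T)⁻¹ := inv_pos.2 (by linarith)
  -- `A` controls the leading eigenvalue, `B` the replacement of `-lam 1` by `β²`, and `E` both the
  -- tail and the size of `negSum`.
  obtain ⟨A, hA⟩ : ∃ A : ℝ, A = 2 * R * Real.exp R := ⟨_, rfl⟩
  obtain ⟨B, hB⟩ : ∃ B : ℝ, B = R * Real.exp (R * (2 + (1 - T)⁻¹)) := ⟨_, rfl⟩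
  obtain ⟨E, hE⟩ : ∃ E : ℝ, E = 4 ^ R * (1 - (1 / 2 : ℝ) ^ σ)⁻¹ := ⟨_, rfl⟩
  have hA0 : 0 ≤ A := by rw [hA]; positivity
  have hB0 : 0 ≤ B := by rw [hB]; positivity
  have hE0 : 0 ≤ E := by rw [hE]; positivity
  refine ⟨max (2 * A + (B * (4 + (1 - T)⁻¹) + E) + E)
    ((1 - (1 / 2 : ℝ) ^ σ)⁻¹ * (A + (B * (4 + (1 - T)⁻¹) + E))),
    fun β τ lam V h h0 hβ t0 hτ s hs hsR => ?_⟩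
  have t1 : τ < 1 := hτ.trans_lt hT1
  have hq : 0 < β ^ 2 := by positivity
  have e1 := h.norm_lam_zero_cpow_sub_one_le hβ hsR
  have e2 := h.norm_negSum_sub_le h0 hβ t0 hτ hT1 hσ hs hsR
  have e3 := h.norm_negSum_le h0 hβ t0 t1 hσ hs hsR
  have e4 : ‖((β ^ 2 : ℝ) : ℂ) ^ s‖ ≤ (β ^ 2) ^ σ := norm_cpow_le_of_le_re hq (by linarith) hs
  obtain ⟨e5, -⟩ := rpow_le_half hq hβ hσ
  rw [← hE] at e2 e3
  rw [← hA] at e1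
  have hx0 : 0 ≤ (β ^ 2) ^ σ := by positivity
  generalize (β ^ 2) ^ σ = x at *
  have hx1 : x ≤ 1 := by linarith
  have hxτ : 0 ≤ x * τ := by positivity
  have hxx : 0 ≤ x ^ 2 := sq_nonneg x
  have hxq : x * β ^ 2 ≤ β ^ 2 := mul_le_of_le_one_left hq.le hx1
  obtain ⟨u, hu⟩ : ∃ u, u = β ^ 2 + x * τ + x ^ 2 := ⟨_, rfl⟩
  have hu0 : 0 ≤ u := by rw [hu]; positivity
  have f2 : ‖negSum lam s - ((β ^ 2 : ℝ) : ℂ) ^ s‖ ≤ (B * (4 + (1 - T)⁻¹) + E) * u := by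
    refine e2.trans ?_
    have g1 : x * (R * (4 * β ^ 2 + (1 - T)⁻¹ * τ) * Real.exp (R * (2 + (1 - T)⁻¹))) =
        B * (4 * (x * β ^ 2) + (1 - T)⁻¹ * (x * τ)) := by rw [hB]; ring
    have g2 : 4 * (x * β ^ 2) + (1 - T)⁻¹ * (x * τ) ≤ (4 + (1 - T)⁻¹) * u := by
      rw [add_mul]
      exact add_le_add (by linarith) (mul_le_mul_of_nonneg_left (by linarith) hT'.le)
    rw [g1, add_mul, mul_assoc B]
    exact add_le_add (mul_le_mul_of_nonneg_left g2 hB0)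
      (mul_le_mul_of_nonneg_left (by linarith) hE0)
  have f1 : ‖(lam 0 : ℂ) ^ s - 1‖ ≤ A * u :=
    e1.trans (mul_le_mul_of_nonneg_left (by linarith) hA0)
  have f3 : ‖((β ^ 2 : ℝ) : ℂ) ^ s * negSum lam s‖ ≤ E * u := by
    rw [norm_mul]
    calc _ ≤ x * (E * x) := mul_le_mul e4 e3 (norm_nonneg _) hx0
      _ = E * x ^ 2 := by ring
      _ ≤ E * u := mul_le_mul_of_nonneg_left (by linarith) hE0
  have hfin := euler_factor_bounds f1 f2 f3 (e4.trans (by linarith)) hδ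
  rw [← hu]
  refine ⟨hfin.1.trans ?_, hfin.2.trans ?_⟩
  · rw [show 2 * (A * u) + (B * (4 + (1 - T)⁻¹) + E) * u + E * u =
      (2 * A + (B * (4 + (1 - T)⁻¹) + E) + E) * u by ring]
    exact mul_le_mul_of_nonneg_right (le_max_left _ _) hu0
  · rw [← add_mul, ← mul_assoc]
    exact mul_le_mul_of_nonneg_right (le_max_right _ _) hu0

theorem IsLocalSpectrum.differentiableOn_negSum (h : IsLocalSpectrum β τ lam V) (h0 : 0 < β)
    (hβ : β ^ 2 ≤ 1 / 2) (t0 : 0 < τ) (t1 : τ < 1) {σ R : ℝ} (hσ : 0 < σ) :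
    DifferentiableOn ℂ (negSum lam) {s : ℂ | σ < s.re ∧ ‖s‖ < R} := by
  obtain ⟨e1, e2⟩ := rpow_le_half (by positivity : 0 < β ^ 2) hβ hσ
  refine Complex.differentiableOn_tsum_of_summable_norm
    (u := fun k => 4 ^ R * (β ^ 2) ^ σ * ((β ^ 2) ^ σ) ^ k)
    ((summable_geometric_of_lt_one (by positivity) (e1.trans_lt e2)).mul_left _) (fun k s _ => ?_)
    ?_ fun k s hs => ?_
  · refine DifferentiableAt.differentiableWithinAt ?_
    refine (differentiableAt_id).const_cpow (Or.inl ?_)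
    exact_mod_cast (neg_pos.2 (h.neg k)).ne'
  · exact (isOpen_lt continuous_const Complex.continuous_re).inter
      (isOpen_lt continuous_norm continuous_const)
  · rw [Complex.norm_cpow_eq_rpow_re_of_pos (neg_pos.2 (h.neg k))]
    exact h.rpow_neg_lam_le h0 hβ t0 t1 hσ hs.1.le ((Complex.re_le_norm s).trans hs.2.le) k

end EulerFactors

/-! ### Analyticity and convergence of the Euler products. -/

section EulerProducts

open Filter Topology

variable {ι : Type*} {β τ : ι → ℝ} {lam : ι → ℕ → ℝ} {V : ι → ℕ → ℕ → ℝ}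

theorem isOpen_halfPlane_inter_ball (σ R : ℝ) : IsOpen {s : ℂ | σ < s.re ∧ ‖s‖ < R} :=
  (isOpen_lt continuous_const Complex.continuous_re).inter
    (isOpen_lt continuous_norm continuous_const)

theorem differentiableOn_tprod_of_bound {K : Set ℂ} (hK : IsOpen K) {f : ι → ℂ → ℂ} {u : ι → ℝ}
    (hu : Summable u) (h : ∀ i, ∀ s ∈ K, ‖f i s - 1‖ ≤ u i)
    (hf : ∀ i, DifferentiableOn ℂ (f i) K) :
    DifferentiableOn ℂ (fun s => ∏' i, f i s) K := by
  have hp := Summable.hasProdLocallyUniformlyOn_one_add (f := fun i s => f i s - 1) hK hu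
    (Eventually.of_forall h) fun i => ((hf i).sub_const 1).continuousOn
  simp only [add_sub_cancel] at hp
  rw [hasProdLocallyUniformlyOn_iff_tendstoLocallyUniformlyOn] at hp
  exact hp.differentiableOn (Eventually.of_forall fun S =>
    DifferentiableOn.fun_finsetProd fun i _ => hf i) hK

theorem differentiableOn_euler_factors (h0 : ∀ i, 0 < β i) (hβ : ∀ i, β i ^ 2 ≤ 1 / 2)
    (t0 : ∀ i, 0 < τ i) (t1 : ∀ i, τ i < 1)
    (h : ∀ i, IsLocalSpectrum (β i) (τ i) (lam i) (V i)) {σ R : ℝ} (hσ : 0 < σ) (i : ι) :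
    DifferentiableOn ℂ (fun s => (1 - ((β i ^ 2 : ℝ) : ℂ) ^ s) *
      ((lam i 0 : ℂ) ^ s + negSum (lam i) s)) {s : ℂ | σ < s.re ∧ ‖s‖ < R} ∧
    DifferentiableOn ℂ (fun s => (1 - ((β i ^ 2 : ℝ) : ℂ) ^ s)⁻¹ *
      ((lam i 0 : ℂ) ^ s - negSum (lam i) s)) {s : ℂ | σ < s.re ∧ ‖s‖ < R} := by
  have hq : 0 < β i ^ 2 := pow_pos (h0 i) 2
  have hpow : ∀ x : ℝ, 0 < x → DifferentiableOn ℂ (fun s : ℂ => (x : ℂ) ^ s)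
      {s : ℂ | σ < s.re ∧ ‖s‖ < R} := fun x hx s _ =>
    (differentiableAt_id.const_cpow (Or.inl (by exact_mod_cast hx.ne'))).differentiableWithinAt
  have hneg := (h i).differentiableOn_negSum (R := R) (h0 i) (hβ i) (t0 i) (t1 i) hσ
  have hL := hpow _ (h i).lam_zero_pos
  have hQ := (hpow _ hq).const_sub 1
  refine ⟨hQ.mul (hL.add hneg), (hQ.inv fun s hs hz => ?_).mul (hL.sub hneg)⟩
  obtain ⟨e1, e2⟩ := rpow_le_half hq (hβ i) hσ
  have h1 := norm_cpow_le_of_le_re hq (by linarith [hβ i]) hs.1.le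
  rw [← sub_eq_zero.1 hz, norm_one] at h1
  linarith

theorem analyticOnNhd_euler_products (h0 : ∀ i, 0 < β i) (hβ : ∀ i, β i ^ 2 ≤ 1 / 2)
    (t0 : ∀ i, 0 < τ i) {T : ℝ} (hτ : ∀ i, τ i ≤ T) (hT : T < 1)
    (h : ∀ i, IsLocalSpectrum (β i) (τ i) (lam i) (V i)) {σ : ℝ} (hσ : 0 < σ)
    (hu : Summable fun i => β i ^ 2 + (β i ^ 2) ^ σ * τ i + ((β i ^ 2) ^ σ) ^ 2) :
    AnalyticOnNhd ℂ (fun s => ∏' i, (1 - ((β i ^ 2 : ℝ) : ℂ) ^ s) *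
      ((lam i 0 : ℂ) ^ s + negSum (lam i) s)) {s : ℂ | σ < s.re} ∧
    AnalyticOnNhd ℂ (fun s => ∏' i, (1 - ((β i ^ 2 : ℝ) : ℂ) ^ s)⁻¹ *
      ((lam i 0 : ℂ) ^ s - negSum (lam i) s)) {s : ℂ | σ < s.re} := by
  have t1 : ∀ i, τ i < 1 := fun i => (hτ i).trans_lt hT
  have hopen : IsOpen {s : ℂ | σ < s.re} := isOpen_lt continuous_const Complex.continuous_re
  -- The constant depends on a bound for `‖s‖`, so the half-plane is exhausted by bounded pieces.
  have hloc : ∀ R : ℝ, 0 ≤ R → DifferentiableOn ℂ (fun s => ∏' i, (1 - ((β i ^ 2 : ℝ) : ℂ) ^ s) *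
      ((lam i 0 : ℂ) ^ s + negSum (lam i) s)) {s : ℂ | σ < s.re ∧ ‖s‖ < R} ∧
    DifferentiableOn ℂ (fun s => ∏' i, (1 - ((β i ^ 2 : ℝ) : ℂ) ^ s)⁻¹ *
      ((lam i 0 : ℂ) ^ s - negSum (lam i) s)) {s : ℂ | σ < s.re ∧ ‖s‖ < R} := by
    intro R hR
    obtain ⟨C, hC⟩ := exists_bound_euler_factors hσ hR hT
    have hb := fun i s (hs : s ∈ {s : ℂ | σ < s.re ∧ ‖s‖ < R}) =>
      hC (β i) (τ i) (lam i) (V i) (h i) (h0 i) (hβ i) (t0 i) (hτ i) s hs.1.le hs.2.le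
    have hd := differentiableOn_euler_factors h0 hβ t0 t1 h (R := R) hσ
    exact ⟨differentiableOn_tprod_of_bound (isOpen_halfPlane_inter_ball σ R) (hu.mul_left C)
        (fun i s hs => (hb i s hs).1) fun i => (hd i).1,
      differentiableOn_tprod_of_bound (isOpen_halfPlane_inter_ball σ R) (hu.mul_left C)
        (fun i s hs => (hb i s hs).2) fun i => (hd i).2⟩
  have hnhds : ∀ s ∈ {s : ℂ | σ < s.re},
      {z : ℂ | σ < z.re ∧ ‖z‖ < ‖s‖ + 1} ∈ 𝓝 s := fun s hs =>
    (isOpen_halfPlane_inter_ball σ (‖s‖ + 1)).mem_nhds ⟨hs, by simp⟩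
  constructor
  · refine DifferentiableOn.analyticOnNhd (fun s hs => ?_) hopen
    exact ((hloc (‖s‖ + 1) (by positivity)).1.differentiableAt (hnhds s hs)).differentiableWithinAt
  · refine DifferentiableOn.analyticOnNhd (fun s hs => ?_) hopen
    exact ((hloc (‖s‖ + 1) (by positivity)).2.differentiableAt (hnhds s hs)).differentiableWithinAt

theorem signedPow_euler_product (h0 : ∀ i, 0 < β i) (hβ : ∀ i, β i ^ 2 ≤ 1 / 2)
    (t0 : ∀ i, 0 < τ i) (t1 : ∀ i, τ i < 1) (hsum : Summable fun i => β i ^ 2)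
    (h : ∀ i, IsLocalSpectrum (β i) (τ i) (lam i) (V i)) {ε s : ℂ} (hε : ε * ε = 1)
    (hs : 0 < s.re) (hsum' : Summable fun i => (β i ^ 2) ^ s.re) :
    (Summable fun f : ι →₀ ℕ => ‖signedPow ε s (tensorEigenvalue lam f)‖) ∧
    (Multipliable fun i => (lam i 0 : ℂ) ^ s + ε * negSum (lam i) s) ∧
    ∑' f : ι →₀ ℕ, signedPow ε s (tensorEigenvalue lam f) =
      ∏' i, ((lam i 0 : ℂ) ^ s + ε * negSum (lam i) s) := by
  have hne : ∀ i k, lam i k ≠ 0 := fun i k => (h i).lam_ne_zero k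
  have hε1 : ‖ε‖ = 1 := by
    have := congr_arg norm hε
    rw [norm_mul, norm_one] at this
    nlinarith [norm_nonneg ε]
  have hsm : ∀ i, Summable fun k => ‖((-lam i (k + 1) : ℝ) : ℂ) ^ s‖ := fun i =>
    (h i).summable_neg (h0 i) (hβ i) (t0 i) (t1 i) hs
  have hsucc : ∀ i k, signedPow ε s (lam i (k + 1)) = ε * ((-lam i (k + 1) : ℝ) : ℂ) ^ s :=
    fun i k => signedPow_of_neg ((h i).neg k)
  have hzero : ∀ i, signedPow ε s (lam i 0) = (lam i 0 : ℂ) ^ s := fun i =>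
    signedPow_of_pos (h i).lam_zero_pos
  have hnorm : ∀ i k, ‖signedPow ε s (lam i (k + 1))‖ = ‖((-lam i (k + 1) : ℝ) : ℂ) ^ s‖ :=
    fun i k => by rw [hsucc, norm_mul, hε1, one_mul]
  have hs' : ∀ i, Summable fun k => ‖signedPow ε s (lam i k)‖ := fun i => by
    rw [← summable_nat_add_iff 1]
    exact (hsm i).congr fun k => (hnorm i k).symm
  have c0 : Summable fun i => ‖signedPow ε s (lam i 0) - 1‖ := by
    refine (hsum.mul_left (2 * ‖s‖ * Real.exp ‖s‖)).of_nonneg_of_le (fun _ => norm_nonneg _)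
      fun i => ?_
    rw [hzero]
    exact (h i).norm_lam_zero_cpow_sub_one_le (hβ i) le_rfl
  have c1 : Summable fun i => ∑' k, ‖signedPow ε s (lam i (k + 1))‖ := by
    refine (hsum'.mul_left (4 ^ ‖s‖ * (1 - (1 / 2 : ℝ) ^ s.re)⁻¹)).of_nonneg_of_le
      (fun _ => tsum_nonneg fun _ => norm_nonneg _) fun i => ?_
    simp only [hnorm]
    have := (h i).tsum_norm_tail_le (h0 i) (hβ i) (t0 i) (t1 i) hs le_rfl le_rfl (R := ‖s‖) 0
    simpa using this
  obtain ⟨-, e2, e3, e4⟩ := euler_expansion (g := fun i k => signedPow ε s (lam i k)) c0 hs' c1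
  have hprod : ∀ f : ι →₀ ℕ, ∏' i, signedPow ε s (lam i (f i)) =
      signedPow ε s (tensorEigenvalue lam f) := fun f =>
    (HasProd.signedPow hε (fun i => hne i (f i)) (tensorEigenvalue_ne_zero hβ hsum h f)
      (multipliable_lam hβ hsum h f).hasProd).tprod_eq
  have hfac : ∀ i, ∑' k, signedPow ε s (lam i k) = (lam i 0 : ℂ) ^ s + ε * negSum (lam i) s := by
    intro i
    rw [(hs' i).of_norm.tsum_eq_zero_add, hzero]
    simp only [hsucc]
    rw [tsum_mul_left]
    rfl
  simp only [hprod] at e2 e4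
  simp only [hfac] at e3 e4
  exact ⟨e2, e3, e4⟩

end EulerProducts

/-! ### From the eigenbasis to the two factorisations. -/

section Assembly

open Filter Topology

theorem posEig_properties {ι : Type*} (b : HilbertBasis ι ℂ EllTwo) {A : EllTwo →L[ℂ] EllTwo}
    {μ : ι → ℝ} (hA : ∀ i, A (b i) = (μ i : ℂ) • b i)
    (hfin : ∀ c, 0 < c → {i | c < μ i}.Finite) (hinf : {i | 0 < μ i}.Infinite) :
    IsPosEigListing A (posEig A) ∧
    (∀ x : ℝ, 0 < x → {n : ℕ | 1 / x < posEig A n}.Finite) ∧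
    Monotone (countFn (posEig A)) ∧
    ∀ s : ℂ, (Summable fun i : {i | 0 < μ i} => ‖((μ i : ℝ) : ℂ) ^ s‖) →
      MellinStieltjesConv (countFn (posEig A)) s ∧
      (Summable fun n : ℕ => ‖((posEig A n : ℝ) : ℂ) ^ s‖) ∧
      eigTransform A s = ∑' n : ℕ, ((posEig A n : ℝ) : ℂ) ^ s ∧
      eigTransform A s = ∑' i : {i | 0 < μ i}, ((μ i : ℝ) : ℂ) ^ s := by
  have hlist := posEig_eq_listing b hA hfin
  obtain ⟨e, he⟩ := exists_equiv_listing hfin hinf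
  have hpos : ∀ n, 0 < posEig A n := fun n => by
    rw [hlist]; exact listing_pos hfin hinf n
  have hfin' : ∀ c, 0 < c → {n | c < posEig A n}.Finite := fun c hc => by
    rw [hlist, ← Set.encard_lt_top_iff, encard_setOf_lt_listing hfin hc]
    exact (hfin c hc).encard_lt_top
  refine ⟨isPosEigListing_posEig b hA hfin hinf, fun x hx => hfin' _ (one_div_pos.2 hx),
    monotone_countFn hpos hfin', fun s hs => ?_⟩
  have hval : ∀ n, ((posEig A n : ℝ) : ℂ) ^ s = ((μ (e n) : ℝ) : ℂ) ^ s := fun n => by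
    rw [hlist, he]
  have hs' : Summable fun n : ℕ => ‖((posEig A n : ℝ) : ℂ) ^ s‖ := by
    simp only [hval]
    exact e.summable_iff.2 hs
  obtain ⟨h1, h2⟩ := mellinStieltjes_countFn hpos hfin' hs'
  refine ⟨h1, hs', h2, h2.trans ?_⟩
  simp only [hval]
  exact e.tsum_eq fun i : {i | 0 < μ i} => ((μ i : ℝ) : ℂ) ^ s

theorem tsum_signedPow_split {ι : Type*} {μ : ι → ℝ} {ε s : ℂ} (hμ : ∀ i, μ i ≠ 0)
    (hs : Summable fun i => ‖signedPow ε s (μ i)‖) :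
    ∑' i, signedPow ε s (μ i) = ∑' i : {i | 0 < μ i}, ((μ i : ℝ) : ℂ) ^ s +
      ε * ∑' i : {i | 0 < -μ i}, ((-μ i : ℝ) : ℂ) ^ s := by
  rw [← hs.of_norm.tsum_subtype_add_tsum_subtype_compl {i | 0 < μ i}]
  have hcompl : {i | 0 < μ i}ᶜ = {i | 0 < -μ i} := by
    ext i
    simp only [Set.mem_compl_iff, Set.mem_ofPred_eq, not_lt, neg_pos]
    exact ⟨fun h => lt_of_le_of_ne h (hμ i), le_of_lt⟩
  rw [hcompl, ← tsum_mul_left]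
  congr 1
  · exact tsum_congr fun i => signedPow_of_pos i.2
  · exact tsum_congr fun i => signedPow_of_neg (neg_pos.1 i.2)

theorem summable_pos_part {ι : Type*} {μ : ι → ℝ} {s : ℂ}
    (hs : Summable fun i => ‖signedPow 1 s (μ i)‖) :
    (Summable fun i : {i | 0 < μ i} => ‖((μ i : ℝ) : ℂ) ^ s‖) ∧
      Summable fun i : {i | 0 < -μ i} => ‖((-μ i : ℝ) : ℂ) ^ s‖ := by
  constructor
  · exact (hs.subtype {i | 0 < μ i}).congr fun i => by
      rw [Function.comp_apply, signedPow_of_pos i.2]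
  · exact (hs.subtype {i | 0 < -μ i}).congr fun i => by
      rw [Function.comp_apply, signedPow_of_neg (neg_pos.1 i.2), one_mul]

theorem finite_of_summable_signedPow {ι : Type*} {μ : ι → ℝ} (hμ : ∀ i, μ i ≠ 0)
    (hs : Summable fun i => ‖signedPow 1 2 (μ i)‖) {c : ℝ} (hc : 0 < c) :
    {i | c < |μ i|}.Finite := by
  have h := hs.tendsto_cofinite_zero.eventually_lt_const (pow_pos hc 2)
  refine (Filter.eventually_cofinite.1 h).subset fun i hi => ?_
  have hi' : c < |μ i| := hi
  rw [Set.mem_ofPred_eq, norm_signedPow (one_mul 1) (hμ i), not_lt]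
  have : ((2 : ℂ)).re = ((2 : ℕ) : ℝ) := by simp
  rw [this, Real.rpow_natCast]
  gcongr

variable {ρ t : ℝ}

theorem primeβ_sq_rpow (p : Nat.Primes) (σ : ℝ) :
    (primeβ ρ t p ^ 2) ^ σ = ((p : ℕ) : ℝ) ^ (-((ρ - t) * σ)) := by
  rw [primeβ_sq, ← Real.rpow_mul (prime_pos p).le, neg_mul]

theorem summable_primeβ_sq_rpow {σ : ℝ} (hσ : 1 < (ρ - t) * σ) :
    Summable fun p => (primeβ ρ t p ^ 2) ^ σ := by
  simp only [primeβ_sq_rpow]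
  exact Nat.Primes.summable_rpow.2 (by linarith)

theorem primeβ_sq_cpow (p : Nat.Primes) (s : ℂ) :
    ((primeβ ρ t p ^ 2 : ℝ) : ℂ) ^ s = ((p : ℕ) : ℂ) ^ (-(((ρ - t : ℝ) : ℂ) * s)) := by
  have hq : ((primeβ ρ t p ^ 2 : ℝ) : ℂ) ≠ 0 := by
    exact_mod_cast (pow_pos (primeβ_pos (ρ := ρ) (t := t) p) 2).ne'
  have hp : (((p : ℕ) : ℝ) : ℂ) ≠ 0 := by exact_mod_cast (prime_pos p).ne'
  rw [← Complex.ofReal_natCast, Complex.cpow_def_of_ne_zero hq, Complex.cpow_def_of_ne_zero hp,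
    ← Complex.ofReal_log (by positivity), ← Complex.ofReal_log (by positivity), primeβ_sq,
    Real.log_rpow (prime_pos p)]
  congr 1
  push_cast
  ring

theorem zeta_mul_tprod (s : ℂ) (hs : 1 < (ρ - t) * s.re) :
    (Multipliable fun p => 1 - ((primeβ ρ t p ^ 2 : ℝ) : ℂ) ^ s) ∧
    HasProd (fun p => (1 - ((primeβ ρ t p ^ 2 : ℝ) : ℂ) ^ s)⁻¹)
      (riemannZeta (((ρ - t : ℝ) : ℂ) * s)) ∧
    riemannZeta (((ρ - t : ℝ) : ℂ) * s) *
      ∏' p, (1 - ((primeβ ρ t p ^ 2 : ℝ) : ℂ) ^ s) = 1 := by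
  have hre : 1 < (((ρ - t : ℝ) : ℂ) * s).re := by rwa [Complex.re_ofReal_mul]
  have hz := riemannZeta_eulerProduct_hasProd hre
  simp only [← primeβ_sq_cpow] at hz
  have hQ : ∀ p, ‖((primeβ ρ t p ^ 2 : ℝ) : ℂ) ^ s‖ = (primeβ ρ t p ^ 2) ^ s.re := fun p =>
    Complex.norm_cpow_eq_rpow_re_of_pos (pow_pos (primeβ_pos p) 2) s
  have hm : Multipliable fun p => 1 - ((primeβ ρ t p ^ 2 : ℝ) : ℂ) ^ s := by
    have : Summable fun p => ‖-((primeβ ρ t p ^ 2 : ℝ) : ℂ) ^ s‖ := by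
      simp only [norm_neg, hQ]
      exact summable_primeβ_sq_rpow hs
    exact (multipliable_one_add_of_summable this).congr fun p => by ring
  refine ⟨hm, hz, (hz.mul hm.hasProd).unique (hasProd_one.congr_fun fun p => ?_)⟩
  refine inv_mul_cancel₀ fun h0 => ?_
  have h1 := congr_arg norm (sub_eq_zero.1 h0)
  rw [norm_one, primeβ_sq_cpow, Complex.norm_natCast_cpow_of_pos p.2.pos, Complex.neg_re] at h1
  have : ((p : ℕ) : ℝ) ^ (-(((ρ - t : ℝ) : ℂ) * s).re) < 1 :=
    Real.rpow_lt_one_of_one_lt_of_neg (by linarith [prime_two_le p]) (by linarith)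
  linarith

theorem exists_abscissa (ht : 0 < t) (hρ : t + 1 < ρ) :
    ∃ s₁ : ℝ, 0 < s₁ ∧ s₁ < 1 / (ρ - t) ∧ Summable fun p =>
      primeβ ρ t p ^ 2 + (primeβ ρ t p ^ 2) ^ s₁ * primeτ t p + ((primeβ ρ t p ^ 2) ^ s₁) ^ 2 := by
  have ha : 0 < ρ - t := by linarith
  obtain ⟨y, hy0, hy1, hy2, hy3⟩ : ∃ y : ℝ, 0 < y ∧ y < 1 ∧ 1 < y + t ∧ 1 < 2 * y := by
    -- With `y = (ρ - t) s₁`, the mixed term is `p ^ (-(y + t))` and the squared term `p ^ (-2y)`.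
    -- Both are summable for `y` slightly below `1`, precisely because `t > 0`.
    refine ⟨max (1 - t / 2) (3 / 4), ?_, ?_, ?_, ?_⟩
    · exact lt_max_of_lt_right (by norm_num)
    · exact max_lt (by linarith) (by norm_num)
    · linarith [le_max_left (1 - t / 2) (3 / 4 : ℝ)]
    · linarith [le_max_right (1 - t / 2) (3 / 4 : ℝ)]
  refine ⟨y / (ρ - t), by positivity, by gcongr, ((summable_primeβ_sq hρ).add ?_).add ?_⟩
  · simp only [primeβ_sq_rpow, mul_div_cancel₀ y ha.ne', primeτ, ← Real.rpow_add (prime_pos _)]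
    exact Nat.Primes.summable_rpow.2 (by linarith)
  · have hp : ∀ p : Nat.Primes, (((p : ℕ) : ℝ) ^ (-y)) ^ 2 = ((p : ℕ) : ℝ) ^ (-(2 * y)) := fun p => by
      rw [sq, ← Real.rpow_add (prime_pos p)]
      ring_nf
    simp only [primeβ_sq_rpow, mul_div_cancel₀ y ha.ne', hp]
    exact Nat.Primes.summable_rpow.2 (by linarith)

theorem eigenvalue_sums (ht : 0 < t) (hρ : t + 1 < ρ) {lam : Nat.Primes → ℕ → ℝ}
    {V : Nat.Primes → ℕ → ℕ → ℝ}
    (hV : ∀ p, IsLocalSpectrum (primeβ ρ t p) (primeτ t p) (lam p) (V p))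
    (e : ℕ+ ≃ (Nat.Primes →₀ ℕ)) {μ : ℕ+ → ℝ} (hμ : ∀ n, μ n = tensorEigenvalue lam (e n)) :
    (∀ n, μ n ≠ 0) ∧ {n | 0 < μ n}.Infinite ∧ {n | 0 < -μ n}.Infinite ∧
    ∀ (ε s : ℂ), ε * ε = 1 → 1 < (ρ - t) * s.re →
      (Summable fun n => ‖signedPow ε s (μ n)‖) ∧
      (Multipliable fun p => (lam p 0 : ℂ) ^ s + ε * negSum (lam p) s) ∧
      ∑' n, signedPow ε s (μ n) = ∏' p, ((lam p 0 : ℂ) ^ s + ε * negSum (lam p) s) := by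
  have ha : 0 < ρ - t := by linarith
  have hβ := primeβ_sq_le (t := t) hρ
  have hsum := summable_primeβ_sq (t := t) hρ
  have hinf : ∀ P : ℝ → Prop, {f | P (tensorEigenvalue lam f)}.Infinite → {n | P (μ n)}.Infinite :=
    fun P h => by
      have : {n | P (μ n)} = e ⁻¹' {f | P (tensorEigenvalue lam f)} := by
        ext n
        simp only [Set.mem_preimage, Set.mem_ofPred_eq, hμ]
      rw [this]
      exact h.preimage fun f _ => e.surjective f
  refine ⟨fun n => ?_, hinf (fun x => 0 < x) ?_, hinf (fun x => 0 < -x) ?_, fun ε s hε hs => ?_⟩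
  · rw [hμ]
    exact tensorEigenvalue_ne_zero hβ hsum hV _
  · exact infinite_tensorEigenvalue_pos hβ hsum hV (i := ⟨2, Nat.prime_two⟩)
      (j := ⟨3, Nat.prime_three⟩) fun h => absurd (Subtype.ext_iff.1 h) (by norm_num)
  · exact infinite_tensorEigenvalue_neg hβ hsum hV ⟨2, Nat.prime_two⟩
  · obtain ⟨e1, e2, e3⟩ := signedPow_euler_product (fun p => primeβ_pos (ρ := ρ) (t := t) p) hβ
      (fun p => primeτ_pos (t := t) p) (primeτ_lt_one ht) hsum hV hε
      (pos_of_mul_pos_right (one_pos.trans hs) ha.le) (summable_primeβ_sq_rpow hs)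
    simp only [hμ]
    refine ⟨e.summable_iff.2 e1, e2, ?_⟩
    rw [← e3]
    exact e.tsum_eq fun f => signedPow ε s (tensorEigenvalue lam f)

end Assembly

theorem lemma4p2 (ρ t : ℝ) (ht : 0 < t) (hρ : t + 1 < ρ)
    (E : EllTwo →L[ℂ] EllTwo) (hE : E = opE ρ t ht hρ) :
    -- for A = E and A = -E:
    (∀ A : EllTwo →L[ℂ] EllTwo, A = E ∨ A = -E →
      -- `posEig A` lists all positive eigenvalues of `A` with multiplicities
      IsPosEigListing A (posEig A) ∧
      -- the counting function is finite and non-decreasing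
      (∀ x : ℝ, 0 < x → {n : ℕ | 1 / x < posEig A n}.Finite) ∧
      Monotone (countFn (posEig A)) ∧
      -- absolute convergence of the integral and of the series, and their equality
      ∀ s : ℂ, 1 / (ρ - t) < s.re →
        MellinStieltjesConv (countFn (posEig A)) s ∧
        (Summable fun n : ℕ => ‖((posEig A n : ℝ) : ℂ) ^ s‖) ∧
        eigTransform A s = ∑' n : ℕ, ((posEig A n : ℝ) : ℂ) ^ s) ∧
    -- the factorisations
    ∃ s₁ : ℝ, s₁ < 1 / (ρ - t) ∧ ∃ ftilde htilde : ℂ → ℂ,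
      AnalyticOnNhd ℂ ftilde {s : ℂ | s₁ < s.re} ∧
      AnalyticOnNhd ℂ htilde {s : ℂ | s₁ < s.re} ∧
      ∀ s : ℂ, 1 / (ρ - t) < s.re →
        fSum E s = riemannZeta (((ρ - t : ℝ) : ℂ) * s) * ftilde s ∧
        hDiff E s = htilde s / riemannZeta (((ρ - t : ℝ) : ℂ) * s) := by
  have ha : 0 < ρ - t := by linarith
  obtain ⟨lam, V, hV, b, hb⟩ := exists_eigenbasis_opE ht hρ
  rw [← hE] at hb
  have h0 := fun p => primeβ_pos (ρ := ρ) (t := t) p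
  have hβ := primeβ_sq_le (t := t) hρ
  have t0 := fun p => primeτ_pos (t := t) p
  obtain ⟨μ, hμdef⟩ : ∃ μ : ℕ+ → ℝ, ∀ n, μ n = tensorEigenvalue lam (primeExponents n) :=
    ⟨_, fun _ => rfl⟩
  simp only [← hμdef] at hb
  obtain ⟨hμ, hinfpos, hinfneg, hprod⟩ := eigenvalue_sums ht hρ hV primeExponents hμdef
  have hone : (1 : ℂ) * 1 = 1 := one_mul 1
  have hneg : (-1 : ℂ) * -1 = 1 := by norm_num
  have habs : ∀ c : ℝ, 0 < c → {n | c < |μ n|}.Finite := fun c hc =>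
    -- Finiteness of the counts comes from square-summability of the eigenvalues; `s = 2` is
    -- admissible as `ρ - t > 1`.
    finite_of_summable_signedPow hμ (hprod 1 2 hone (by
      rw [Complex.re_ofNat]; linarith)).1 hc
  have hb' : ∀ n, (-E) (b n) = ((-μ n : ℝ) : ℂ) • b n := fun n => by
    rw [neg_apply, hb, Complex.ofReal_neg, neg_smul]
  have hP := posEig_properties b hb (fun c hc => (habs c hc).subset fun n hn =>
    show c < |μ n| from lt_of_lt_of_le hn (le_abs_self _)) hinfpos
  have hN := posEig_properties b hb' (fun c hc => (habs c hc).subset fun n hn =>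
    show c < |μ n| from lt_of_lt_of_le hn (neg_le_abs _)) hinfneg
  have hre : ∀ s : ℂ, 1 / (ρ - t) < s.re → 1 < (ρ - t) * s.re := fun s hs => by
    rwa [div_lt_iff₀' ha] at hs
  refine ⟨?_, ?_⟩
  · rintro A (rfl | rfl)
    · refine ⟨hP.1, hP.2.1, hP.2.2.1, fun s hs => ?_⟩
      obtain ⟨e1, e2, e3, -⟩ := hP.2.2.2 s (summable_pos_part (hprod 1 s hone (hre s hs)).1).1
      exact ⟨e1, e2, e3⟩
    · refine ⟨hN.1, hN.2.1, hN.2.2.1, fun s hs => ?_⟩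
      obtain ⟨e1, e2, e3, -⟩ := hN.2.2.2 s (summable_pos_part (hprod 1 s hone (hre s hs)).1).2
      exact ⟨e1, e2, e3⟩
  · obtain ⟨s₁, hs0, hs1, hu⟩ := exists_abscissa ht hρ
    -- The prime `2` gives a bound below `1` for all `τ`, which keeps `(1 - τ)⁻¹` uniformly bounded.
    have hT : ∀ p, primeτ t p ≤ (2 : ℝ) ^ (-t) := fun p =>
      Real.rpow_le_rpow_of_nonpos two_pos (prime_two_le p) (by linarith)
    have hT1 : (2 : ℝ) ^ (-t) < 1 := Real.rpow_lt_one_of_one_lt_of_neg one_lt_two (by linarith)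
    obtain ⟨hf, hh⟩ := analyticOnNhd_euler_products h0 hβ t0 hT hT1 hV hs0 hu
    -- The witnesses are the Euler products with the zeta factors removed. To the right of `1/(ρ -
    -- t)` all products converge separately and can be recombined.
    refine ⟨s₁, hs1, _, _, hf, hh, fun s hs => ?_⟩
    obtain ⟨z1, z2, z3⟩ := zeta_mul_tprod (ρ := ρ) (t := t) s (hre s hs)
    obtain ⟨p1, p2, p3⟩ := hprod 1 s hone (hre s hs)
    obtain ⟨m1, m2, m3⟩ := hprod (-1) s hneg (hre s hs)
    have eP := (hP.2.2.2 s (summable_pos_part p1).1).2.2.2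
    have eN := (hN.2.2.2 s (summable_pos_part p1).2).2.2.2
    rw [tsum_signedPow_split hμ p1, ← eP, ← eN] at p3
    rw [tsum_signedPow_split hμ m1, ← eP, ← eN] at m3
    simp only [one_mul] at p2 p3
    simp only [neg_mul, one_mul, ← sub_eq_add_neg] at m2 m3
    have hζ : riemannZeta (((ρ - t : ℝ) : ℂ) * s) ≠ 0 := left_ne_zero_of_mul_eq_one z3
    constructor
    · rw [fSum, p3, z1.tprod_mul p2, ← mul_assoc, z3, one_mul]
    · rw [hDiff, m3, z2.multipliable.tprod_mul m2, z2.tprod_eq, mul_div_cancel_left₀ _ hζ]
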